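/- Let $\mathcal K$ be a finite-dimensional complex Hilbert space, $\mathcal K\neq\{0\}$, with orthonormal basis $e^1,\dots,e^{\dim\mathcal K}$; let masses $m_{[\alpha]}>0$ ($\alpha=1,\dots,\dim\mathcal K$) be given and put $m_\circ:=\min_\alpha m_{[\alpha]}$. Let $n\ge 1$, $s>0$, and let $\mathcal C_n\subset(-\pi,0)^{\times n}$ be an open polyhedron (the interior of the convex hull of a finite subset of $\mathbb R^n$) containing $\boldsymbol\lambda_{\pi/2}:=-(\tfrac\pi2,\dots,\tfrac\pi2)$. Let $c_n>0$ be the distance of $\boldsymbol\lambda_{\pi/2}$ to the boundary $\partial\mathcal C_n$ in the maximum norm; then $c_n\le\frac\pi2$. Let $H^2(\mathcal T,\mathcal K^{\otimes n})$, $\mathcal T:=\mathbb R^n+i\,\mathcal C_n$, be the Hardy space of all analytic $h:\mathcal T\to\mathcal K^{\otimes n}$ for which the functions $h_{\boldsymbol\lambda}:\boldsymbol\theta\mapsto h(\boldsymbol\theta+i\boldsymbol\lambda)$, $\boldsymbol\lambda\in\mathcal C_n$, lie in $L^2(\mathbb R^n,\mathcal K^{\otimes n})$ with finite norm $|||h|||:=\sup_{\boldsymbol\lambda\in\mathcal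 C_n}\|h_{\boldsymbol\lambda}\|_2$, and define $$X_{\mathcal C_n,s}:H^2(\mathcal T,\mathcal K^{\otimes n})\to L^2(\mathbb R^n,\mathcal K^{\otimes n}),\qquad (X_{\mathcal C_n,s}h)^{\boldsymbol\alpha}(\boldsymbol\theta):=\prod_{k=1}^n e^{-\frac s2 m_{[\alpha_k]}\cosh\theta_k}\cdot h^{\boldsymbol\alpha}_{\boldsymbol\lambda_{\pi/2}}(\boldsymbol\theta),$$ where $\boldsymbol\alpha=(\alpha_1,\dots,\alpha_n)$ labels the components with respect to $e^{\alpha_1}\otimes\cdots\otimes e^{\alpha_n}$. Let $P_n^-$ be the orthogonal projection onto the completely antisymmetric subspace of $L^2(\mathbb R^n,\mathcal K^{\otimes n})\cong L^2(\mathbb R,\mathcal K)^{\otimes n}$, i.e. the subspace of all $\Psi$ with $\Psi^{\alpha_{\sigma(1)}\cdots\alpha_{\sigma(n)}}(\theta_{\sigma(1)},\dots,\theta_{\sigma(n)})=\operatorname{sgn}(\sigma)\,\Psi^{\alpha_1\cdots\alpha_n}(\theta_1,\dots,\theta_n)$ for all permutations $\sigma$. Then $P_n^-X_{\mathcal C_n,s}$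 is nuclear: there are bounded linear functionals $\varphi_j$ and vectors $y_j$ ($j\in\mathbb N$) with $\sum_j\|\varphi_j\|\,\|y_j\|<\infty$ and $P_n^-X_{\mathcal C_n,s}h=\sum_j\varphi_j(h)\,y_j$ for all $h$. Its nuclear norm, the infimum of $\sum_j\|\varphi_j\|\,\|y_j\|$ over all such representations, satisfies $$\|P_n^-X_{\mathcal C_n,s}\|_1\le\frac{2^n}{n!}\left(\frac{\dim\mathcal K}{(\frac12\pi m_\circ)^{1/2}}\cdot\frac{e^{-\frac{s m_\circ}{2}\cos c_n}}{c_n\,(s\cos c_n)^{1/2}}\right)^n,$$ where for $c_n=\frac\pi2$ the right-hand side is read as $+\infty$. -/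

import Mathlib

open MeasureTheory
open scoped ENNReal

noncomputable section

namespace PauliHardy

/-! ### Nuclear maps between normed spaces -/

section Nuclear

variable {X Y : Type*} [NormedAddCommGroup X] [NormedSpace ℂ X]
  [NormedAddCommGroup Y] [NormedSpace ℂ Y]

/-- The sequences `φ` of functionals and `y` of vectors represent `T` as
`T x = ∑ φ j x • y j` for all `x`, with `∑ ‖φ j‖ ‖y j‖ < ∞`. -/
def IsNuclearRep (T : X →L[ℂ] Y) (φ : ℕ → (X →L[ℂ] ℂ)) (y : ℕ → Y) : Prop :=
  Summable (fun j => ‖φ j‖ * ‖y j‖) ∧ ∀ x, HasSum (fun j => φ j x • y j) (T x)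

/-- Nuclear maps. -/
def IsNuclear (T : X →L[ℂ] Y) : Prop :=
  ∃ φ y, IsNuclearRep T φ y

/-- The nuclear norm: the infimum of `∑ ‖φ j‖ ‖y j‖` over all representations
(meaningful for nuclear `T`). -/
def nuclearNorm (T : X →L[ℂ] Y) : ℝ :=
  sInf {r | ∃ φ y, IsNuclearRep T φ y ∧ r = ∑' j, ‖φ j‖ * ‖y j‖}

end Nuclear

/-! ### Hardy spaces on tubes -/

section Hardy

variable {n : ℕ}

/-- The tube `ℝⁿ + i C`. -/
def tube (C : Set (Fin n → ℝ)) : Set (Fin n → ℂ) :=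
  {z | (fun k => (z k).im) ∈ C}

/-- The point `θ + i lam` of `ℂⁿ`. -/
def cpoint (lam θ : Fin n → ℝ) : Fin n → ℂ :=
  fun k => (θ k : ℂ) + Complex.I * (lam k : ℂ)

lemma cpoint_mem_tube {C : Set (Fin n → ℝ)} {lam : Fin n → ℝ} (h : lam ∈ C) (θ : Fin n → ℝ) :
    cpoint lam θ ∈ tube C := by
  simpa [tube, cpoint] using h

lemma continuous_cpoint (lam : Fin n → ℝ) : Continuous (cpoint lam) := by
  unfold cpoint; fun_prop

variable {E : Type*} [NormedAddCommGroup E] [NormedSpace ℂ E]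

lemma continuous_slice {C : Set (Fin n → ℝ)} {h : (Fin n → ℂ) → E}
    (hh : AnalyticOnNhd ℂ h (tube C)) {lam : Fin n → ℝ} (hl : lam ∈ C) :
    Continuous (fun θ => h (cpoint lam θ)) :=
  hh.continuousOn.comp_continuous (continuous_cpoint lam) (cpoint_mem_tube hl)

/-- The `L²`-norm of the slice `θ ↦ h (θ + i lam)`. -/
def sliceNorm (h : (Fin n → ℂ) → E) (lam : Fin n → ℝ) : ℝ :=
  (eLpNorm (fun θ => h (cpoint lam θ)) 2 volume).toReal

lemma sliceNorm_add_le {h g : (Fin n → ℂ) → E} {lam : Fin n → ℝ}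
    (hh : MemLp (fun θ => h (cpoint lam θ)) 2 volume)
    (hg : MemLp (fun θ => g (cpoint lam θ)) 2 volume) :
    sliceNorm (h + g) lam ≤ sliceNorm h lam + sliceNorm g lam := by
  unfold sliceNorm
  rw [← ENNReal.toReal_add hh.2.ne hg.2.ne]
  exact ENNReal.toReal_mono (ENNReal.add_ne_top.2 ⟨hh.2.ne, hg.2.ne⟩)
    (eLpNorm_add_le hh.1 hg.1 (by norm_num))

lemma sliceNorm_smul (c : ℂ) (h : (Fin n → ℂ) → E) (lam : Fin n → ℝ) :
    sliceNorm (c • h) lam = ‖c‖ * sliceNorm h lam := by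
  unfold sliceNorm
  have : (fun θ => (c • h) (cpoint lam θ)) = c • (fun θ => h (cpoint lam θ)) := rfl
  rw [this, eLpNorm_const_smul, ENNReal.toReal_mul]
  simp

/-- The Hardy space `H²(ℝⁿ + i C, E)`: functions analytic on the tube, all of whose slices
are square integrable, with uniformly bounded `L²`-norms.
A function on the tube is represented by its extension by zero to `ℂⁿ`. -/
def hardySubmodule (C : Set (Fin n → ℝ)) (E : Type*) [NormedAddCommGroup E] [NormedSpace ℂ E] :
    Submodule ℂ ((Fin n → ℂ) → E) where
  carrier := {h | AnalyticOnNhd ℂ h (tube C) ∧ (∀ z, z ∉ tube C → h z = 0) ∧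
    (∀ lam ∈ C, MemLp (fun θ => h (cpoint lam θ)) 2 volume) ∧
    ∃ B : ℝ, ∀ lam ∈ C, sliceNorm h lam ≤ B}
  add_mem' := by
    rintro a b ⟨a1, a2, a3, Ba, a4⟩ ⟨b1, b2, b3, Bb, b4⟩
    refine ⟨a1.add b1, fun z hz => by simp [a2 z hz, b2 z hz],
      fun lam hl => (a3 lam hl).add (b3 lam hl), Ba + Bb, fun lam hl => ?_⟩
    exact (sliceNorm_add_le (a3 lam hl) (b3 lam hl)).trans
      (add_le_add (a4 lam hl) (b4 lam hl))
  zero_mem' := by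
    refine ⟨analyticOnNhd_const, fun z _ => rfl, fun lam _ => ?_, 0, fun lam _ => ?_⟩
    · exact MemLp.zero'
    · simp [sliceNorm]
  smul_mem' := by
    rintro c a ⟨a1, a2, a3, Ba, a4⟩
    refine ⟨analyticOnNhd_const.smul a1, fun z hz => by simp [a2 z hz],
      fun lam hl => (a3 lam hl).const_smul c, ‖c‖ * Ba, fun lam hl => ?_⟩
    rw [sliceNorm_smul]
    exact mul_le_mul_of_nonneg_left (a4 lam hl) (norm_nonneg c)

/-- The Hardy space as a type. -/
def Hardy (C : Set (Fin n → ℝ)) (E : Type*) [NormedAddCommGroup E] [NormedSpace ℂ E] : Type _ :=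
  hardySubmodule C E

variable {C : Set (Fin n → ℝ)}

instance : AddCommGroup (Hardy C E) := inferInstanceAs (AddCommGroup (hardySubmodule C E))

instance : Module ℂ (Hardy C E) := inferInstanceAs (Module ℂ (hardySubmodule C E))

instance : CoeFun (Hardy C E) (fun _ => (Fin n → ℂ) → E) := ⟨fun h => h.1⟩

@[simp] lemma Hardy.add_apply (h g : Hardy C E) (z : Fin n → ℂ) : (h + g) z = h z + g z := rfl

@[simp] lemma Hardy.smul_apply (c : ℂ) (h : Hardy C E) (z : Fin n → ℂ) :
    (c • h) z = c • h z := rfl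

/-- The Hardy norm: the supremum of the `L²`-norms of the slices over `lam ∈ C`. -/
instance : Norm (Hardy C E) := ⟨fun h => ⨆ lam : C, sliceNorm h lam⟩

lemma Hardy.norm_def (h : Hardy C E) : ‖h‖ = ⨆ lam : C, sliceNorm h lam := rfl

lemma Hardy.memLp (h : Hardy C E) {lam : Fin n → ℝ} (hl : lam ∈ C) :
    MemLp (fun θ => h (cpoint lam θ)) 2 volume := h.2.2.2.1 lam hl

lemma Hardy.sliceNorm_le (h : Hardy C E) {lam : Fin n → ℝ} (hl : lam ∈ C) :
    sliceNorm h lam ≤ ‖h‖ := by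
  obtain ⟨B, hB⟩ := h.2.2.2.2
  have : BddAbove (Set.range fun lam : C => sliceNorm h lam) :=
    ⟨B, by rintro _ ⟨l, rfl⟩; exact hB l l.2⟩
  exact le_ciSup this ⟨lam, hl⟩

lemma Hardy.norm_nonneg' (h : Hardy C E) : 0 ≤ ‖h‖ :=
  Real.iSup_nonneg fun _ => ENNReal.toReal_nonneg

lemma hardyCore : NormedSpace.Core ℂ (Hardy C E) where
  norm_nonneg := Hardy.norm_nonneg'
  norm_smul c h := by
    have : ∀ lam : C, sliceNorm (c • h : Hardy C E) lam = ‖c‖ * sliceNorm h lam :=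
      fun lam => sliceNorm_smul c _ _
    rw [Hardy.norm_def, Hardy.norm_def, Real.mul_iSup_of_nonneg (norm_nonneg c)]
    exact iSup_congr this
  norm_triangle h g := by
    refine Real.iSup_le (fun lam => ?_) (add_nonneg h.norm_nonneg' g.norm_nonneg')
    exact (sliceNorm_add_le (h.memLp lam.2) (g.memLp lam.2)).trans
      (add_le_add (h.sliceNorm_le lam.2) (g.sliceNorm_le lam.2))
  norm_eq_zero_iff h := by
    constructor
    · intro h0
      apply Subtype.ext
      funext z
      by_cases hz : z ∈ tube C
      · have hl : (fun k => (z k).im) ∈ C := hz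
        have h1 : sliceNorm h (fun k => (z k).im) = 0 :=
          le_antisymm (h0 ▸ h.sliceNorm_le hl) ENNReal.toReal_nonneg
        have h2 := h.memLp hl
        have h3 : eLpNorm (fun θ => h (cpoint (fun k => (z k).im) θ)) 2 volume = 0 :=
          ((ENNReal.toReal_eq_zero_iff _).1 h1).resolve_right h2.2.ne
        rw [eLpNorm_eq_zero_iff h2.1 (by norm_num)] at h3
        have h4 := (Continuous.ae_eq_iff_eq volume (continuous_slice h.2.1 hl)
          continuous_const).1 h3
        have h5 := congrFun h4 (fun k => (z k).re)
        have h6 : cpoint (fun k => (z k).im) (fun k => (z k).re) = z := by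
          funext k
          simp only [cpoint]
          rw [mul_comm]
          exact Complex.re_add_im (z k)
        rw [h6] at h5
        exact h5
      · exact h.2.2.1 z hz
    · rintro rfl
      have : ∀ lam : C, sliceNorm (0 : Hardy C E) lam = 0 := fun lam => by
        change sliceNorm (0 : (Fin n → ℂ) → E) lam = 0
        simp [sliceNorm]
      rw [Hardy.norm_def]
      simp only [this]
      exact Real.iSup_const_zero

instance : NormedAddCommGroup (Hardy C E) := NormedAddCommGroup.ofCore hardyCore

instance : NormedSpace ℂ (Hardy C E) := NormedSpace.ofCore hardyCore

end Hardy

/-! ### The spaces and operators of the model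

The one-particle multiplet space is `K = ℂ^ι` with its standard orthonormal basis
`e^α`, `α : ι`, and `dim K = card ι`. Vectors of `K^{⊗ n}` are given by their components
with respect to the orthonormal basis `e^{α₁} ⊗ ⋯ ⊗ e^{αₙ}`. -/

section Model

variable (n : ℕ) (ι : Type*) [Fintype ι]

/-- `K^{⊗ n}`, in components `v^{α₁ … αₙ}`. -/
abbrev TensorK : Type _ := EuclideanSpace ℂ (Fin n → ι)

/-- `L²(ℝⁿ, K^{⊗ n})`. -/
abbrev L2 : Type _ := Lp (TensorK n ι) 2 (volume : Measure (Fin n → ℝ))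

variable {n ι}

/-- Permutation of the tensor factors of `K^{⊗ n}`: `v ↦ (α ↦ v^{α_{σ(1)} … α_{σ(n)}})`. -/
def permTensor (σ : Equiv.Perm (Fin n)) : TensorK n ι ≃ₗᵢ[ℂ] TensorK n ι :=
  LinearIsometryEquiv.piLpCongrLeft 2 ℂ ℂ (Equiv.arrowCongr σ (Equiv.refl ι))

@[simp] lemma permTensor_apply (σ : Equiv.Perm (Fin n)) (v : TensorK n ι) (α : Fin n → ι) :
    permTensor σ v α = v (α ∘ σ) := rfl

lemma measurePreserving_perm (σ : Equiv.Perm (Fin n)) :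
    MeasurePreserving (fun θ : Fin n → ℝ => θ ∘ σ) volume volume := by
  have h := volume_measurePreserving_piCongrLeft (fun _ : Fin n => ℝ) σ.symm
  convert h using 1
  funext θ k
  have := Equiv.piCongrLeft_apply_apply (fun _ : Fin n => ℝ) σ.symm θ (σ k)
  rw [Equiv.symm_apply_apply] at this
  exact this.symm

/-- Permutation of the tensor factors of `L²(ℝⁿ, K^{⊗ n}) ≅ L²(ℝ, K)^{⊗ n}`, acting on
rapidities and on internal indices simultaneously, see `permL2_apply`. -/
def permL2 (σ : Equiv.Perm (Fin n)) : L2 n ι →L[ℂ] L2 n ι :=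
  ((permTensor σ).toContinuousLinearEquiv.toContinuousLinearMap.compLpL 2 volume).comp
    (Lp.compMeasurePreservingₗᵢ ℂ (fun θ : Fin n → ℝ => θ ∘ σ)
      (measurePreserving_perm σ)).toContinuousLinearMap

lemma permL2_apply (σ : Equiv.Perm (Fin n)) (Ψ : L2 n ι) :
    ∀ᵐ θ, ∀ α, permL2 σ Ψ θ α = Ψ (θ ∘ σ) (α ∘ σ) := by
  have h1 := ContinuousLinearMap.coeFn_compLpL (p := 2) (μ := volume)
    (permTensor (ι := ι) σ).toContinuousLinearEquiv.toContinuousLinearMap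
    (Lp.compMeasurePreserving (fun θ : Fin n → ℝ => θ ∘ σ) (measurePreserving_perm σ) Ψ)
  have h2 := Lp.coeFn_compMeasurePreserving Ψ (measurePreserving_perm σ)
  filter_upwards [h1, h2] with θ h1 h2 α
  calc permL2 σ Ψ θ α = permTensor σ (Lp.compMeasurePreserving (fun θ : Fin n → ℝ => θ ∘ σ)
          (measurePreserving_perm σ) Ψ θ) α := congrArg (fun v : TensorK n ι => v α) h1
    _ = _ := by rw [h2]; rfl

/-- The completely antisymmetric subspace of `L²(ℝⁿ, K^{⊗ n}) ≅ L²(ℝ, K)^{⊗ n}`. -/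
def antisymm (n : ℕ) (ι : Type*) [Fintype ι] : Submodule ℂ (L2 n ι) where
  carrier := {Ψ | ∀ σ : Equiv.Perm (Fin n), permL2 σ Ψ = ((Equiv.Perm.sign σ : ℤ) : ℂ) • Ψ}
  add_mem' := by
    intro a b ha hb σ
    rw [map_add, ha σ, hb σ, smul_add]
  zero_mem' := by
    intro σ
    rw [map_zero, smul_zero]
  smul_mem' := by
    intro c a ha σ
    rw [map_smul, ha σ, smul_comm]

lemma isClosed_antisymm : IsClosed (antisymm n ι : Set (L2 n ι)) := by
  have : (antisymm n ι : Set (L2 n ι)) = ⋂ σ : Equiv.Perm (Fin n),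
      {Ψ | permL2 σ Ψ = ((Equiv.Perm.sign σ : ℤ) : ℂ) • Ψ} := by
    ext Ψ; simp [antisymm]
  rw [this]
  exact isClosed_iInter fun σ =>
    isClosed_eq (permL2 σ).continuous (continuous_const_smul _)

instance : CompleteSpace (antisymm n ι) := isClosed_antisymm.completeSpace_coe

/-- The orthogonal projection `P_n^-` onto the completely antisymmetric subspace. -/
def projAntisymm (n : ℕ) (ι : Type*) [Fintype ι] : L2 n ι →L[ℂ] L2 n ι :=
  (antisymm n ι).starProjection

/-- The point `(-π/2, …, -π/2)`. -/
def lamHalfPi (n : ℕ) : Fin n → ℝ := fun _ => -(Real.pi / 2)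

/-- Open polyhedra: interiors of convex hulls of finite sets. -/
def IsOpenPolyhedron (C : Set (Fin n → ℝ)) : Prop :=
  ∃ F : Set (Fin n → ℝ), F.Finite ∧ C = interior (convexHull ℝ F)

/-- The distance of `(-π/2, …, -π/2)` to the boundary of `C` in the maximum norm
(which is the norm of `Fin n → ℝ`). -/
def boundaryDist (C : Set (Fin n → ℝ)) : ℝ :=
  Metric.infDist (lamHalfPi n) (frontier C)

/-- The mass gap, i.e. the minimum of the masses. -/
def massGap [Nonempty ι] (m : ι → ℝ) : ℝ :=
  Finset.univ.inf' Finset.univ_nonempty m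

/-- The function `θ ↦ ∏ₖ exp(-(s/2) m_{αₖ} cosh θₖ) h^α(θ + i lam)`, `lam = (-π/2, …, -π/2)`. -/
def xFun (m : ι → ℝ) (s : ℝ) (h : (Fin n → ℂ) → TensorK n ι) (θ : Fin n → ℝ) : TensorK n ι :=
  WithLp.toLp 2 fun α =>
    ((∏ k, Real.exp (-(s / 2) * m (α k) * Real.cosh (θ k)) : ℝ) : ℂ) *
      h (cpoint (lamHalfPi n) θ) α

lemma norm_xFun_le {m : ι → ℝ} (hm : ∀ a, 0 < m a) {s : ℝ} (hs : 0 < s)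
    (h : (Fin n → ℂ) → TensorK n ι) (θ : Fin n → ℝ) :
    ‖xFun m s h θ‖ ≤ ‖h (cpoint (lamHalfPi n) θ)‖ := by
  rw [EuclideanSpace.norm_eq, EuclideanSpace.norm_eq]
  refine Real.sqrt_le_sqrt (Finset.sum_le_sum fun α _ => ?_)
  refine pow_le_pow_left₀ (norm_nonneg _) ?_ 2
  simp only [xFun, norm_mul, Complex.norm_real, Real.norm_eq_abs]
  refine mul_le_of_le_one_left (norm_nonneg _) ?_
  rw [abs_of_nonneg (Finset.prod_nonneg fun k _ => (Real.exp_pos _).le)]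
  refine Finset.prod_le_one (fun k _ => (Real.exp_pos _).le) fun k _ => ?_
  rw [Real.exp_le_one_iff]
  have := mul_pos (mul_pos (half_pos hs) (hm (α k))) (Real.cosh_pos (θ k))
  linarith

lemma memLp_xFun {m : ι → ℝ} (hm : ∀ a, 0 < m a) {s : ℝ} (hs : 0 < s)
    {C : Set (Fin n → ℝ)} (hC : lamHalfPi n ∈ C) (h : Hardy C (TensorK n ι)) :
    MemLp (xFun m s h) 2 volume := by
  refine (h.memLp hC).mono ?_ (Filter.Eventually.of_forall (norm_xFun_le hm hs h))
  have hc := continuous_slice h.2.1 hC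
  refine Continuous.aestronglyMeasurable ?_
  unfold xFun
  refine (PiLp.continuous_toLp 2 _).comp (continuous_pi fun α => ?_)
  refine Continuous.mul ?_ ((EuclideanSpace.proj (𝕜 := ℂ) α).continuous.comp hc)
  fun_prop

/-- The operator `X_{C,s} : H²(ℝⁿ + i C, K^{⊗ n}) → L²(ℝⁿ, K^{⊗ n})`,
`(X h)^α(θ) = ∏ₖ exp(-(s/2) m_{αₖ} cosh θₖ) · h^α(θ + i lam)`, `lam = (-π/2, …, -π/2) ∈ C`. -/
def opX {m : ι → ℝ} (hm : ∀ a, 0 < m a) {s : ℝ} (hs : 0 < s)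
    {C : Set (Fin n → ℝ)} (hC : lamHalfPi n ∈ C) :
    Hardy C (TensorK n ι) →L[ℂ] L2 n ι :=
  LinearMap.mkContinuous
    { toFun := fun h => (memLp_xFun hm hs hC h).toLp (xFun m s h)
      map_add' := by
        intro h g
        rw [← MemLp.toLp_add]
        congr 1
        funext θ
        ext α
        simp [xFun, mul_add]
      map_smul' := by
        intro c h
        rw [RingHom.id_apply, ← MemLp.toLp_const_smul]
        congr 1
        funext θ
        ext α
        simp [xFun, mul_left_comm] }
    1
    (by
      intro h
      rw [one_mul]
      refine le_trans ?_ (h.sliceNorm_le hC)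
      change ‖(memLp_xFun hm hs hC h).toLp (xFun m s h)‖ ≤ _
      rw [Lp.norm_toLp]
      exact ENNReal.toReal_mono (h.memLp hC).2.ne (eLpNorm_mono (norm_xFun_le hm hs h)))

lemma opX_apply {m : ι → ℝ} (hm : ∀ a, 0 < m a) {s : ℝ} (hs : 0 < s)
    {C : Set (Fin n → ℝ)} (hC : lamHalfPi n ∈ C) (h : Hardy C (TensorK n ι)) :
    opX hm hs hC h =ᵐ[volume] xFun m s h :=
  (memLp_xFun hm hs hC h).coeFn_toLp

end Model

end PauliHardy

end

open PauliHardy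

/-! The weight of `opX` is the square of `coshWeight` with exponents `s * m i / 4`. One factor stays
with `h`, which makes every slice of `h` near the base point integrable by Cauchy–Schwarz; the other
goes to the output vector and makes it square integrable.

Fix `c` below both π/2 and the distance to the boundary. The slice at the base point is recovered
from its Fourier transform, and on each orthant of frequencies `q` the contour is moved to the
corner of the cube of radius `c` that produces the factor `∏ exp (-2πc|q k|)`
(`fourierT_weightedSlice`). Splitting this factor evenly writes the operator as a sum over
components and corners of integrals over `q` of rank one operators (`inner_opX`). The functionals
factor through `cornerSlices`, a map of norm at most `√(2 ^ n)`; they and the output vectors are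
given by product vectors. Counting the corner labels as internal indices makes this family invariant
under simultaneous permutations.

Invariance allows the antisymmetrizer to act on the functionals as well as on the vectors
(`sum_integral_projAntisymm`). The squared norm of an antisymmetrized product vector is a Gram
determinant divided by `n!`, so Hadamard's inequality gains `1 / √n!` on each side, hence `1 / n!`
in total. Finally, each integral of rank one operators is a product of two Hilbert–Schmidt operators
through `L²` of the frequencies, and its nuclear norm is at most the product of their
Hilbert–Schmidt norms (`nuclear_of_integral_rank_one`). Collecting constants gives the bound for
every such `c`, and `c` then increases to the distance itself. -/

open PauliHardy

/-! ### Nuclearity of products of Hilbert–Schmidt operators -/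

section NuclearHS

variable {X Y Z : Type*} [NormedAddCommGroup X] [NormedSpace ℂ X]

lemma nuclear_of_hasSum_nat [NormedAddCommGroup Y] [NormedSpace ℂ Y] {T : X →L[ℂ] Y}
    {φ : ℕ → (X →L[ℂ] ℂ)} {y : ℕ → Y} (h : IsNuclearRep T φ y) :
    IsNuclear T ∧ nuclearNorm T ≤ ∑' j, ‖φ j‖ * ‖y j‖ := by
  refine ⟨⟨φ, y, h⟩, csInf_le ⟨0, ?_⟩ ⟨φ, y, h, rfl⟩⟩
  rintro r ⟨φ, y, -, rfl⟩
  exact tsum_nonneg fun j => by positivity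

/-- Hilbert bases come with arbitrary index types. Summability leaves only countably many nonzero
terms; these are injected into `ℕ` and the remaining places are filled with zeros. -/
lemma nuclear_of_hasSum [NormedAddCommGroup Y] [NormedSpace ℂ Y] {T : X →L[ℂ] Y}
    {J : Type*} (φ : J → (X →L[ℂ] ℂ)) (y : J → Y)
    (hs : Summable fun j => ‖φ j‖ * ‖y j‖) (hT : ∀ x, HasSum (fun j => φ j x • y j) (T x)) :
    IsNuclear T ∧ nuclearNorm T ≤ ∑' j, ‖φ j‖ * ‖y j‖ := by
  set A : Set J := Function.support fun j => ‖φ j‖ * ‖y j‖ with hA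
  have hAc : Countable A := hs.countable_support.to_subtype
  obtain ⟨e, he⟩ := exists_injective_nat A
  let φ' : ℕ → (X →L[ℂ] ℂ) := Function.extend e (fun a : A => φ a) 0
  let y' : ℕ → Y := Function.extend e (fun a : A => y a) 0
  have h1 : (fun j => ‖φ' j‖ * ‖y' j‖) =
      Function.extend e (fun a : A => ‖φ a‖ * ‖y a‖) 0 := by
    funext j
    by_cases hj : ∃ a, e a = j
    · obtain ⟨a, rfl⟩ := hj
      simp [φ', y', he.extend_apply]
    · simp [φ', y', Function.extend_apply' _ _ _ hj]
  have h2 : ∀ x, (fun j => φ' j x • y' j) =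
      Function.extend e (fun a : A => φ a x • y a) 0 := by
    intro x
    funext j
    by_cases hj : ∃ a, e a = j
    · obtain ⟨a, rfl⟩ := hj
      simp [φ', y', he.extend_apply]
    · simp [φ', y', Function.extend_apply' _ _ _ hj]
  have h3 : HasSum (fun j => ‖φ' j‖ * ‖y' j‖) (∑' j, ‖φ j‖ * ‖y j‖) := by
    rw [h1, hasSum_extend_zero he]
    exact (hasSum_subtype_iff_of_support_subset (f := fun j => ‖φ j‖ * ‖y j‖)
      (le_refl _)).2 hs.hasSum
  have h4 : IsNuclearRep T φ' y' := by
    refine ⟨h3.summable, fun x => ?_⟩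
    rw [h2, hasSum_extend_zero he]
    refine (hasSum_subtype_iff_of_support_subset (f := fun j => φ j x • y j) ?_).2 (hT x)
    intro j hj
    simp only [hA, Function.mem_support] at hj ⊢
    intro h0
    rcases mul_eq_zero.1 h0 with h0 | h0
    · exact hj (by simp [norm_eq_zero.1 h0])
    · exact hj (by simp [norm_eq_zero.1 h0])
  rw [← h3.tsum_eq]
  exact nuclear_of_hasSum_nat h4

variable {S : Type*} [MeasurableSpace S] {μ : Measure S}

lemma integrable_smul_of_memLp_two [NormedAddCommGroup Y] [NormedSpace ℂ Y] {f : S → ℂ}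
    {y : S → Y} (hf : MemLp f 2 μ) (hy : MemLp y 2 μ) : Integrable (fun t => f t • y t) μ :=
  memLp_one_iff_integrable.1 (hy.smul hf)

lemma norm_integral_smul_le [NormedAddCommGroup Y] [NormedSpace ℂ Y] {f : S → ℂ}
    {y : S → Y} (hf : MemLp f 2 μ) (hy : MemLp y 2 μ) :
    ‖∫ t, f t • y t ∂μ‖ ≤ (eLpNorm f 2 μ).toReal * (eLpNorm y 2 μ).toReal := by
  refine (norm_integral_le_integral_norm _).trans ?_
  change ∫ t, ‖(f • y) t‖ ∂μ ≤ _
  rw [integral_norm_eq_lintegral_enorm (hf.1.smul hy.1), ← ENNReal.toReal_mul,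
    ← eLpNorm_one_eq_lintegral_enorm]
  exact ENNReal.toReal_mono (ENNReal.mul_ne_top hf.2.ne hy.2.ne)
    (eLpNorm_smul_le_mul_eLpNorm hy.1 hf.1)

/-- Integration of scalar `L²` functions against a fixed vector valued one. -/
noncomputable def integralAgainst [NormedAddCommGroup Y] [NormedSpace ℂ Y] {y : S → Y}
    (hy : MemLp y 2 μ) : Lp ℂ 2 μ →L[ℂ] Y :=
  LinearMap.mkContinuous
    { toFun := fun f => ∫ t, f t • y t ∂μ
      map_add' := fun f g => by
        rw [← integral_add (integrable_smul_of_memLp_two (Lp.memLp f) hy)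
          (integrable_smul_of_memLp_two (Lp.memLp g) hy)]
        refine integral_congr_ae ?_
        filter_upwards [Lp.coeFn_add f g] with t ht
        rw [ht, Pi.add_apply, add_smul]
      map_smul' := fun c f => by
        rw [RingHom.id_apply, ← integral_smul]
        refine integral_congr_ae ?_
        filter_upwards [Lp.coeFn_smul c f] with t ht
        rw [ht, Pi.smul_apply, smul_assoc] }
    (eLpNorm y 2 μ).toReal
    (fun f => by
      rw [mul_comm, Lp.norm_def]
      exact norm_integral_smul_le (Lp.memLp f) hy)

lemma integralAgainst_apply [NormedAddCommGroup Y] [NormedSpace ℂ Y] {y : S → Y}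
    (hy : MemLp y 2 μ) (f : Lp ℂ 2 μ) : integralAgainst hy f = ∫ t, f t • y t ∂μ := rfl

variable [NormedAddCommGroup Y] [InnerProductSpace ℂ Y]

lemma norm_toLp_sq {y : S → Y} (hy : MemLp y 2 μ) : ‖hy.toLp y‖ ^ 2 = ∫ t, ‖y t‖ ^ 2 ∂μ := by
  have h6 := inner_self_eq_norm_sq_to_K (𝕜 := ℂ) (hy.toLp y)
  rw [L2.inner_def] at h6
  have h7 : ∫ t, inner ℂ (hy.toLp y t) (hy.toLp y t) ∂μ = ((∫ t, ‖y t‖ ^ 2 ∂μ : ℝ) : ℂ) := by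
    rw [← integral_complex_ofReal]
    refine integral_congr_ae ?_
    filter_upwards [hy.coeFn_toLp] with t ht
    rw [ht, inner_self_eq_norm_sq_to_K]; norm_cast
  rw [h7] at h6
  refine Complex.ofReal_injective (Eq.trans ?_ h6.symm)
  push_cast
  rfl

lemma toReal_eLpNorm_two {y : S → Y} (hy : MemLp y 2 μ) :
    (eLpNorm y 2 μ).toReal = √(∫ t, ‖y t‖ ^ 2 ∂μ) := by
  rw [← norm_toLp_sq hy, Real.sqrt_sq (norm_nonneg _), Lp.norm_toLp]

variable [CompleteSpace Y] [NormedAddCommGroup Z] [InnerProductSpace ℂ Z] [CompleteSpace Z]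

/-- The Bessel inequality for vector valued functions. -/
lemma sum_sq_integralAgainst_le {J : Type*} {e : J → Lp ℂ 2 μ} (he : Orthonormal ℂ e)
    {y : S → Y} (hy : MemLp y 2 μ) (F : Finset J) :
    ∑ j ∈ F, ‖integralAgainst hy (e j)‖ ^ 2 ≤ ∫ t, ‖y t‖ ^ 2 ∂μ := by
  classical
  set c : J → Y := fun j => integralAgainst hy (e j) with hc
  -- `g j` is the component of `y` along the conjugate of `e j`. These components are orthogonal
  -- with norms `‖c j‖`, so Bessel is the nonnegativity of `‖y - ∑ g j‖ ^ 2`.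
  let g : J → Lp Y 2 μ := fun j =>
    (ContinuousLinearMap.toSpanSingleton ℂ (c j)).compLp (star (e j))
  have hg : ∀ j, ∀ᵐ t ∂μ, g j t = star (e j t) • c j := by
    intro j
    filter_upwards [ContinuousLinearMap.coeFn_compLp (ContinuousLinearMap.toSpanSingleton ℂ
      (c j)) (star (e j)), Lp.coeFn_star (e j)] with t h1 h2
    rw [h1, h2]
    simp
  have hyg : ∀ j, inner ℂ (g j) (hy.toLp y) = ((‖c j‖ ^ 2 : ℝ) : ℂ) := by
    intro j
    have h1 : inner ℂ (c j) (c j) = ((‖c j‖ ^ 2 : ℝ) : ℂ) := by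
      rw [inner_self_eq_norm_sq_to_K]; norm_cast
    rw [L2.inner_def, ← h1]
    conv_rhs => rw [hc]; simp only [integralAgainst_apply]
    rw [← integral_inner (integrable_smul_of_memLp_two (Lp.memLp (e j)) hy)]
    refine integral_congr_ae ?_
    filter_upwards [hg j, hy.coeFn_toLp] with t h1 h2
    rw [h1, h2, inner_smul_left, inner_smul_right]
    simp [hc, integralAgainst_apply]
  have hgg : ∀ i j, inner ℂ (g i) (g j) = if i = j then ((‖c j‖ ^ 2 : ℝ) : ℂ) else 0 := by
    intro i j
    have h1 : inner ℂ (g i) (g j) = inner ℂ (e j) (e i) * inner ℂ (c i) (c j) := by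
      rw [L2.inner_def, L2.inner_def, ← integral_mul_const]
      refine integral_congr_ae ?_
      filter_upwards [hg i, hg j] with t h1 h2
      rw [h1, h2, inner_smul_left, inner_smul_right]
      simp
      ring
    rw [h1, orthonormal_iff_ite.1 he]
    by_cases h : i = j
    · subst h
      rw [inner_self_eq_norm_sq_to_K]
      simp
    · rw [if_neg (Ne.symm h), if_neg h, zero_mul]
  have key : ‖hy.toLp y - ∑ j ∈ F, g j‖ ^ 2 =
      ‖hy.toLp y‖ ^ 2 - ∑ j ∈ F, ‖c j‖ ^ 2 := by
    rw [norm_sub_sq (𝕜 := ℂ)]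
    have h1 : RCLike.re (inner ℂ (hy.toLp y) (∑ j ∈ F, g j)) = ∑ j ∈ F, ‖c j‖ ^ 2 := by
      rw [inner_re_symm, sum_inner, Finset.sum_congr rfl fun j _ => hyg j]
      rw [← Complex.ofReal_sum]
      exact Complex.ofReal_re _
    have h2 : ‖∑ j ∈ F, g j‖ ^ 2 = ∑ j ∈ F, ‖c j‖ ^ 2 := by
      have : ((‖∑ j ∈ F, g j‖ ^ 2 : ℝ) : ℂ) = ((∑ j ∈ F, ‖c j‖ ^ 2 : ℝ) : ℂ) := by
        have h3 := inner_self_eq_norm_sq_to_K (𝕜 := ℂ) (∑ j ∈ F, g j)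
        have h4 : ((‖∑ j ∈ F, g j‖ ^ 2 : ℝ) : ℂ) = inner ℂ (∑ j ∈ F, g j) (∑ j ∈ F, g j) := by
          rw [h3]; norm_cast
        rw [h4, sum_inner, Complex.ofReal_sum]
        refine Finset.sum_congr rfl fun i hi => ?_
        rw [inner_sum, Finset.sum_congr rfl fun j _ => hgg i j]
        simp [hi]
      exact_mod_cast this
    rw [h1, h2]; ring
  rw [← norm_toLp_sq hy]
  nlinarith [sq_nonneg ‖hy.toLp y - ∑ j ∈ F, g j‖]

/-- An operator which is a finite sum of integrals of rank one operators with square integrable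
factors is nuclear. -/
lemma nuclear_of_integral_rank_one {B : Type*} [Fintype B] (T : X →L[ℂ] Y) (J : X →L[ℂ] Z)
    {v : B → S → Z} {y : B → S → Y} (hv : ∀ b, MemLp (v b) 2 μ) (hy : ∀ b, MemLp (y b) 2 μ)
    (hT : ∀ x φ, inner ℂ φ (T x) =
      ∑ b, ∫ t, inner ℂ (v b t) (J x) * inner ℂ φ (y b t) ∂μ) :
    IsNuclear T ∧ nuclearNorm T ≤
      ∑ b, ‖J‖ * (√(∫ t, ‖v b t‖ ^ 2 ∂μ) * √(∫ t, ‖y b t‖ ^ 2 ∂μ)) := by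
  -- Each summand factors as `X → L²(μ) → Y`; a Hilbert basis inserted in the middle yields the
  -- nuclear representation.
  obtain ⟨w, e, -⟩ := exists_hilbertBasis ℂ (Lp ℂ 2 μ)
  let φ : B × w → (X →L[ℂ] ℂ) := fun p =>
    (innerSL ℂ (integralAgainst (hv p.1) (e p.2))).comp J
  let u : B × w → Y := fun p => integralAgainst (hy p.1) (e p.2)
  have hle : ∀ p, ‖φ p‖ * ‖u p‖ ≤
      ‖J‖ * (‖integralAgainst (hv p.1) (e p.2)‖ * ‖integralAgainst (hy p.1) (e p.2)‖) := by
    intro p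
    have : ‖φ p‖ ≤ ‖integralAgainst (hv p.1) (e p.2)‖ * ‖J‖ := by
      refine (ContinuousLinearMap.opNorm_comp_le _ _).trans ?_
      rw [innerSL_apply_norm]
    calc ‖φ p‖ * ‖u p‖ ≤ (‖integralAgainst (hv p.1) (e p.2)‖ * ‖J‖) * ‖u p‖ := by gcongr
      _ = _ := by simp only [u]; ring
  -- Cauchy–Schwarz over the basis, with Bessel for each of the two factors.
  have hcs : ∀ b, Summable (fun j : w => ‖integralAgainst (hv b) (e j)‖ *
      ‖integralAgainst (hy b) (e j)‖) ∧ ∑' j : w, ‖integralAgainst (hv b) (e j)‖ *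
      ‖integralAgainst (hy b) (e j)‖ ≤ √(∫ t, ‖v b t‖ ^ 2 ∂μ) * √(∫ t, ‖y b t‖ ^ 2 ∂μ) := by
    intro b
    have h3 : ∀ F : Finset w, ∑ j ∈ F, ‖integralAgainst (hv b) (e j)‖ *
        ‖integralAgainst (hy b) (e j)‖ ≤ √(∫ t, ‖v b t‖ ^ 2 ∂μ) * √(∫ t, ‖y b t‖ ^ 2 ∂μ) :=
      fun F => (Real.sum_mul_le_sqrt_mul_sqrt F _ _).trans (mul_le_mul
        (Real.sqrt_le_sqrt (sum_sq_integralAgainst_le e.orthonormal (hv b) F))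
        (Real.sqrt_le_sqrt (sum_sq_integralAgainst_le e.orthonormal (hy b) F))
        (Real.sqrt_nonneg _) (Real.sqrt_nonneg _))
    have h4 := summable_of_sum_le (fun j => by positivity) h3
    exact ⟨h4, h4.tsum_le_of_sum_le h3⟩
  have hsum : HasSum (fun p : B × w => ‖J‖ * (‖integralAgainst (hv p.1) (e p.2)‖ *
      ‖integralAgainst (hy p.1) (e p.2)‖)) (∑ b, ‖J‖ * ∑' j : w,
      ‖integralAgainst (hv b) (e j)‖ * ‖integralAgainst (hy b) (e j)‖) := by
    have hnn : ∀ p : B × w, 0 ≤ ‖J‖ * (‖integralAgainst (hv p.1) (e p.2)‖ *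
      ‖integralAgainst (hy p.1) (e p.2)‖) := fun p => by positivity
    have hS : Summable (fun p : B × w => ‖J‖ * (‖integralAgainst (hv p.1) (e p.2)‖ *
      ‖integralAgainst (hy p.1) (e p.2)‖)) :=
      (summable_prod_of_nonneg hnn).2 ⟨fun b => (hcs b).1.mul_left _, (hasSum_fintype _).summable⟩
    have := hS.hasSum.prod_fiberwise fun b => ((hcs b).1.mul_left ‖J‖).hasSum
    convert hS.hasSum using 1
    rw [← HasSum.unique (hasSum_fintype _) this]
    exact Finset.sum_congr rfl fun b _ => tsum_mul_left.symm
  have hs : Summable fun p => ‖φ p‖ * ‖u p‖ :=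
    hsum.summable.of_nonneg_of_le (fun p => by positivity) hle
  have hrep : ∀ x, HasSum (fun p => φ p x • u p) (T x) := by
    intro x
    have hss : Summable (fun p => φ p x • u p) := by
      refine Summable.of_norm_bounded (hs.mul_right ‖x‖) fun p => ?_
      rw [norm_smul]
      calc ‖φ p x‖ * ‖u p‖ ≤ (‖φ p‖ * ‖x‖) * ‖u p‖ := by
            gcongr; exact (φ p).le_opNorm x
        _ = _ := by ring
    have hL : ∀ b, MemLp (fun t => inner ℂ (v b t) (J x)) 2 μ := fun b =>
      (hv b).inner_const (J x)
    have h1 : ∀ b, HasSum (fun j : w => φ (b, j) x • u (b, j))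
        (integralAgainst (hy b) ((hL b).toLp _)) := by
      intro b
      have := (integralAgainst (hy b)).hasSum (e.hasSum_repr ((hL b).toLp _))
      convert this using 1
      funext j
      -- The coefficient of `t ↦ ⟪v b t, J x⟫` along `e j` is `⟪∫ e j • v b, J x⟫`, which is `φ (b,
      -- j) x`.
      rw [map_smul, e.repr_apply_apply, L2.inner_def]
      congr 1
      simp only [φ, ContinuousLinearMap.comp_apply, innerSL_apply_apply]
      rw [← inner_conj_symm, integralAgainst_apply,
        ← integral_inner (integrable_smul_of_memLp_two (Lp.memLp (e j)) (hv b)), ← integral_conj]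
      refine integral_congr_ae ?_
      filter_upwards [(hL b).coeFn_toLp] with t ht
      rw [ht, inner_smul_right, map_mul, inner_conj_symm]
      simp [mul_comm]
    have h2 : T x = ∑ b, integralAgainst (hy b) ((hL b).toLp _) := by
      refine ext_inner_left ℂ fun ψ => ?_
      rw [hT, inner_sum]
      refine Finset.sum_congr rfl fun b _ => ?_
      rw [integralAgainst_apply, ← integral_inner
        (integrable_smul_of_memLp_two (Lp.memLp _) (hy b))]
      refine integral_congr_ae ?_
      filter_upwards [(hL b).coeFn_toLp] with t ht
      rw [ht, inner_smul_right]
    have h3 := hss.hasSum.prod_fiberwise h1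
    rw [h2, HasSum.unique (hasSum_fintype _) h3]
    exact hss.hasSum
  obtain ⟨h1, h2⟩ := nuclear_of_hasSum φ u hs hrep
  refine ⟨h1, h2.trans ((hs.tsum_le_tsum hle hsum.summable).trans ?_)⟩
  rw [hsum.tsum_eq]
  exact Finset.sum_le_sum fun b _ => mul_le_mul_of_nonneg_left (hcs b).2 (norm_nonneg _)

end NuclearHS

/-! ### Hadamard's inequality -/

section Hadamard

/-- The **Hadamard inequality** for Gram determinants. -/
lemma re_det_gram_le {E : Type*} [NormedAddCommGroup E] [InnerProductSpace ℂ E]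
    {N : Type*} [Fintype N] [DecidableEq N] (v : N → E) :
    (Matrix.gram ℂ v).det.re ≤ ∏ i, ‖v i‖ ^ 2 := by
  by_cases h0 : ∃ i, v i = 0
  · obtain ⟨i, hi⟩ := h0
    rw [Matrix.det_eq_zero_of_row_eq_zero i fun j => by simp [Matrix.gram_apply, hi]]
    exact Finset.prod_nonneg fun i _ => by positivity
  push Not at h0
  -- For unit vectors the Gram matrix is positive semidefinite with trace `card N`; the norms are
  -- restored afterwards as row and column factors.
  let e : N → E := fun i => ((‖v i‖⁻¹ : ℝ) : ℂ) • v i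
  have he : ∀ i, ‖e i‖ = 1 := fun i => by
    simp only [e, norm_smul, Complex.norm_real, norm_inv, norm_norm]
    exact inv_mul_cancel₀ (norm_ne_zero_iff.2 (h0 i))
  have hv : ∀ i, v i = ((‖v i‖ : ℝ) : ℂ) • e i := fun i => by
    simp only [e, smul_smul, ← Complex.ofReal_mul]
    rw [mul_inv_cancel₀ (norm_ne_zero_iff.2 (h0 i))]
    simp
  have hG := Matrix.posSemidef_gram ℂ e
  have h1 : (Matrix.gram ℂ e).det.re ≤ 1 := by
    rw [hG.1.det_eq_prod_eigenvalues]
    have htr : ∑ i, hG.1.eigenvalues i = Fintype.card N := by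
      have h2 := hG.1.trace_eq_sum_eigenvalues
      have h3 : (Matrix.gram ℂ e).trace = ((Fintype.card N : ℝ) : ℂ) := by
        simp only [Matrix.trace, Matrix.diag, Matrix.gram_apply, inner_self_eq_norm_sq_to_K, he]
        simp
      rw [h3] at h2
      refine Complex.ofReal_injective (Eq.trans ?_ h2.symm)
      push_cast
      rfl
    have h4 : (∏ i, (hG.1.eigenvalues i : ℂ)).re = ∏ i, hG.1.eigenvalues i := by
      rw [← Complex.ofReal_prod, Complex.ofReal_re]
    refine h4.le.trans ?_
    -- The inequality `x ≤ exp (x - 1)` plays the role of AM–GM: the exponents add up to trace minus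
    -- `card N`, which is zero.
    calc ∏ i, hG.1.eigenvalues i ≤ ∏ i, Real.exp (hG.1.eigenvalues i - 1) := by
          refine Finset.prod_le_prod (fun i _ => hG.eigenvalues_nonneg i) fun i _ => ?_
          have := Real.add_one_le_exp (hG.1.eigenvalues i - 1)
          linarith
      _ = 1 := by
          rw [← Real.exp_sum, Finset.sum_sub_distrib, htr]
          simp
  have h2 : (Matrix.gram ℂ v).det = ((∏ i, ‖v i‖ ^ 2 : ℝ) : ℂ) * (Matrix.gram ℂ e).det := by
    have h3 : Matrix.gram ℂ v = Matrix.of fun i j => ((‖v i‖ : ℝ) : ℂ) *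
        (Matrix.of fun i j => ((‖v j‖ : ℝ) : ℂ) * Matrix.gram ℂ e i j) i j := by
      ext i j
      simp only [Matrix.of_apply, Matrix.gram_apply]
      conv_lhs => rw [hv i, hv j, inner_smul_left, inner_smul_right, Complex.conj_ofReal]
    rw [h3, Matrix.det_mul_column, Matrix.det_mul_row, ← mul_assoc, ← Finset.prod_mul_distrib]
    push_cast
    simp only [sq]
  rw [h2, Complex.re_ofReal_mul]
  exact mul_le_of_le_one_right (Finset.prod_nonneg fun i _ => by positivity) h1

end Hadamard

/-! ### The antisymmetrizer as a signed average -/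

section Antisymm

variable {n : ℕ} {κ : Type*} [Fintype κ]

lemma measurableEmbedding_perm (σ : Equiv.Perm (Fin n)) :
    MeasurableEmbedding (fun θ : Fin n → ℝ => θ ∘ σ) := by
  convert (MeasurableEquiv.piCongrLeft (fun _ : Fin n => ℝ) σ.symm).measurableEmbedding using 1
  funext θ k
  have := Equiv.piCongrLeft_apply_apply (fun _ : Fin n => ℝ) σ.symm θ (σ k)
  rw [Equiv.symm_apply_apply] at this
  exact this.symm

lemma integral_perm {E : Type*} [NormedAddCommGroup E] [NormedSpace ℝ E]
    (σ : Equiv.Perm (Fin n)) (f : (Fin n → ℝ) → E) : ∫ θ, f (θ ∘ σ) = ∫ θ, f θ :=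
  (measurePreserving_perm σ).integral_comp (measurableEmbedding_perm σ) f

lemma permL2_ae (σ : Equiv.Perm (Fin n)) (Ψ : L2 n κ) :
    ∀ᵐ θ, permL2 σ Ψ θ = permTensor σ (Ψ (θ ∘ σ)) := by
  filter_upwards [permL2_apply σ Ψ] with θ h
  ext α
  rw [h α, permTensor_apply]

lemma permL2_permL2 (σ τ : Equiv.Perm (Fin n)) (Ψ : L2 n κ) :
    permL2 σ (permL2 τ Ψ) = permL2 (σ * τ) Ψ := by
  refine Lp.ext ?_
  filter_upwards [permL2_ae σ (permL2 τ Ψ), permL2_ae (σ * τ) Ψ,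
    (measurePreserving_perm σ).quasiMeasurePreserving.ae (permL2_ae τ Ψ)] with θ h1 h2 h3
  rw [h1, h2, h3]
  rfl

lemma inner_permL2_permL2 (σ : Equiv.Perm (Fin n)) (a b : L2 n κ) :
    inner ℂ (permL2 σ a) (permL2 σ b) = inner ℂ a b := by
  rw [L2.inner_def, L2.inner_def, ← integral_perm σ fun θ => inner ℂ (a θ) (b θ)]
  refine integral_congr_ae ?_
  filter_upwards [permL2_ae σ a, permL2_ae σ b] with θ h1 h2
  rw [h1, h2, LinearIsometryEquiv.inner_map_map]

lemma sign_cast_mul_self (σ : Equiv.Perm (Fin n)) :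
    ((Equiv.Perm.sign σ : ℤ) : ℂ) * ((Equiv.Perm.sign σ : ℤ) : ℂ) = 1 := by
  rcases Int.units_eq_one_or (Equiv.Perm.sign σ) with h | h <;> simp [h]

lemma permL2_inner_antisymm (σ : Equiv.Perm (Fin n)) (Ψ : L2 n κ) {w : L2 n κ}
    (hw : w ∈ antisymm n κ) :
    inner ℂ (permL2 σ Ψ) w = ((Equiv.Perm.sign σ : ℤ) : ℂ) * inner ℂ Ψ w := by
  have h1 : w = permL2 σ (((Equiv.Perm.sign σ : ℤ) : ℂ) • w) := by
    rw [map_smul, hw σ, smul_smul, sign_cast_mul_self, one_smul]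
  conv_lhs => rw [h1, inner_permL2_permL2, inner_smul_right]

/-- The average is antisymmetric because left multiplication permutes the group. Against an
antisymmetric vector every signed term has the same inner product as `Ψ`, so the difference is
orthogonal to the subspace. -/
lemma projAntisymm_eq (Ψ : L2 n κ) :
    projAntisymm n κ Ψ = ((n.factorial : ℂ)⁻¹) •
      ∑ σ : Equiv.Perm (Fin n), ((Equiv.Perm.sign σ : ℤ) : ℂ) • permL2 σ Ψ := by
  have hn : (n.factorial : ℂ) ≠ 0 := Nat.cast_ne_zero.2 n.factorial_ne_zero
  refine Submodule.eq_starProjection_of_mem_of_inner_eq_zero ?_ fun w hw => ?_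
  · intro τ
    rw [map_smul, map_sum, smul_comm]
    congr 1
    rw [Finset.smul_sum, ← Equiv.sum_comp (Equiv.mulLeft τ) fun σ => ((Equiv.Perm.sign τ : ℤ) : ℂ) •
      ((Equiv.Perm.sign σ : ℤ) : ℂ) • permL2 σ Ψ]
    refine Finset.sum_congr rfl fun σ _ => ?_
    rw [map_smul, permL2_permL2, Equiv.coe_mulLeft, smul_smul, Equiv.Perm.sign_mul]
    push_cast
    rw [← mul_assoc, sign_cast_mul_self, one_mul]
  · rw [inner_sub_left, inner_smul_left, sum_inner]
    simp only [inner_smul_left, permL2_inner_antisymm _ _ hw, map_intCast, ← mul_assoc,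
      sign_cast_mul_self, map_inv₀, map_natCast]
    simp [Fintype.card_perm, hn]

lemma projAntisymm_mem (Ψ : L2 n κ) : projAntisymm n κ Ψ ∈ antisymm n κ :=
  Submodule.starProjection_apply_mem _ _

end Antisymm

/-! ### Product vectors and their antisymmetrization -/

section ProductVectors

variable {n : ℕ} {κ : Type*} [Fintype κ]

/-- Continuous square integrable functions on the line. -/
def ContL2 : Type := {f : ℝ → ℂ // Continuous f ∧ MemLp f 2 volume}

open Classical in
/-- The vector valued function `θ ↦ ∏ₖ fₖ(θₖ) e^β`. -/
noncomputable def prodFun (f : Fin n → ℝ → ℂ) (β : Fin n → κ) (θ : Fin n → ℝ) : TensorK n κ :=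
  EuclideanSpace.single β (∏ k, f k (θ k))

lemma inner_prodFun_left (f : Fin n → ℝ → ℂ) (β : Fin n → κ) (θ : Fin n → ℝ) (v : TensorK n κ) :
    inner ℂ (prodFun f β θ) v = (starRingEnd ℂ) (∏ k, f k (θ k)) * v β := by
  classical
  rw [prodFun, EuclideanSpace.inner_single_left]

lemma inner_prodFun_right (f : Fin n → ℝ → ℂ) (β : Fin n → κ) (θ : Fin n → ℝ) (v : TensorK n κ) :
    inner ℂ v (prodFun f β θ) = (∏ k, f k (θ k)) * (starRingEnd ℂ) (v β) := by
  classical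
  rw [prodFun, EuclideanSpace.inner_single_right]

lemma memLp_prod {f : Fin n → ℝ → ℂ} (hc : ∀ k, Continuous (f k))
    (h2 : ∀ k, MemLp (f k) 2 volume) : MemLp (fun θ : Fin n → ℝ => ∏ k, f k (θ k)) 2 volume := by
  have hcont : Continuous (fun θ : Fin n → ℝ => ∏ k, f k (θ k)) :=
    continuous_finsetProd _ fun k _ => (hc k).comp (continuous_apply k)
  rw [memLp_two_iff_integrable_sq_norm hcont.aestronglyMeasurable]
  have h := Integrable.fintype_prod (μ := fun _ : Fin n => (volume : Measure ℝ))
    fun k => (memLp_two_iff_integrable_sq_norm (h2 k).1).1 (h2 k)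
  simp only [norm_prod, ← Finset.prod_pow]
  exact h

lemma memLp_single {S : Type*} [MeasurableSpace S] {μ : Measure S} {β : Type*} [Fintype β]
    [DecidableEq β] {f : S → ℂ} (h2 : MemLp f 2 μ) (b : β) :
    MemLp (fun t => EuclideanSpace.single b (f t)) 2 μ := by
  have hcont : Continuous (fun z : ℂ => (EuclideanSpace.single b z : EuclideanSpace ℂ β)) :=
    (PiLp.continuous_toLp 2 _).comp (continuous_pi fun i => by
      by_cases h : i = b
      · subst h; simpa using continuous_id'
      · simpa [Pi.single_eq_of_ne h] using continuous_const)
  exact h2.mono (hcont.comp_aestronglyMeasurable h2.1)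
    (Filter.Eventually.of_forall fun t => by simp)

lemma memLp_prodFun (f : Fin n → ContL2) (β : Fin n → κ) :
    MemLp (prodFun (fun k => (f k).1) β) 2 volume :=
  by classical exact memLp_single (memLp_prod (fun k => (f k).2.1) fun k => (f k).2.2) β

/-- The product vector `⊗ₖ fₖ e^{βₖ}` of `L²(ℝⁿ, K^{⊗ n})`. -/
noncomputable def prodVec (f : Fin n → ContL2) (β : Fin n → κ) : L2 n κ :=
  (memLp_prodFun f β).toLp _

lemma prodVec_ae (f : Fin n → ContL2) (β : Fin n → κ) :
    prodVec f β =ᵐ[volume] prodFun (fun k => (f k).1) β := (memLp_prodFun f β).coeFn_toLp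

open Classical in
/-- The vector `f e^b` of `L²(ℝ, K)`. -/
noncomputable def oneVec (f : ContL2) (b : κ) : Lp (EuclideanSpace ℂ κ) 2 (volume : Measure ℝ) :=
  (memLp_single f.2.2 b).toLp _

open Classical in
lemma inner_oneVec (f g : ContL2) (a b : κ) :
    inner ℂ (oneVec f a) (oneVec g b) =
      if a = b then ∫ x, (starRingEnd ℂ) (f.1 x) * g.1 x else 0 := by
  rw [L2.inner_def, oneVec, oneVec]
  have h : ∀ᵐ x, inner ℂ ((memLp_single f.2.2 a).toLp _ x) ((memLp_single g.2.2 b).toLp _ x) =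
      if a = b then (starRingEnd ℂ) (f.1 x) * g.1 x else 0 := by
    filter_upwards [(memLp_single f.2.2 a).coeFn_toLp, (memLp_single g.2.2 b).coeFn_toLp]
      with x h1 h2
    rw [h1, h2, EuclideanSpace.inner_single_left]
    by_cases hab : a = b <;> simp [hab]
  rw [integral_congr_ae h]
  split_ifs <;> simp

lemma norm_oneVec_sq (f : ContL2) (b : κ) : ‖oneVec f b‖ ^ 2 = ∫ x, ‖f.1 x‖ ^ 2 := by
  rw [oneVec, norm_toLp_sq]
  simp

lemma inner_prodVec (f g : Fin n → ContL2) (β γ : Fin n → κ) :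
    inner ℂ (prodVec f β) (prodVec g γ) =
      ∏ k, inner ℂ (oneVec (f k) (β k)) (oneVec (g k) (γ k)) := by
  classical
  have h : ∀ᵐ θ, inner ℂ (prodVec f β θ) (prodVec g γ θ) =
      if β = γ then ∏ k, (starRingEnd ℂ) ((f k).1 (θ k)) * (g k).1 (θ k) else 0 := by
    filter_upwards [prodVec_ae f β, prodVec_ae g γ] with θ h1 h2
    rw [h1, h2, inner_prodFun_left, prodFun, PiLp.single_apply, map_prod]
    by_cases hab : β = γ
    · simp [hab, Finset.prod_mul_distrib]
    · simp [hab]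
  rw [L2.inner_def, integral_congr_ae h]
  simp only [inner_oneVec]
  split_ifs with hab
  · subst hab
    simp only [if_true]
    exact integral_fintype_prod_volume_eq_prod
      fun k x => (starRingEnd ℂ) ((f k).1 x) * (g k).1 x
  · obtain ⟨k, hk⟩ := Function.ne_iff.1 hab
    rw [integral_zero, Finset.prod_eq_zero (Finset.mem_univ k) (if_neg hk)]

lemma permL2_prodVec (σ : Equiv.Perm (Fin n)) (f : Fin n → ContL2) (β : Fin n → κ) :
    permL2 σ (prodVec f β) = prodVec (f ∘ σ.symm) (β ∘ σ.symm) := by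
  classical
  refine Lp.ext ?_
  filter_upwards [permL2_ae σ (prodVec f β), prodVec_ae (f ∘ σ.symm) (β ∘ σ.symm),
    (measurePreserving_perm σ).quasiMeasurePreserving.ae (prodVec_ae f β)] with θ h1 h2 h3
  rw [h1, h2, h3]
  ext α
  rw [permTensor_apply, prodFun, prodFun, PiLp.single_apply, PiLp.single_apply]
  have h4 : (α ∘ σ = β) ↔ (α = β ∘ σ.symm) := by
    constructor
    · rintro rfl; ext k; simp
    · rintro rfl; ext k; simp
  have h5 : ∏ k, (f k).1 ((θ ∘ σ) k) = ∏ k, ((f ∘ σ.symm) k).1 (θ k) := by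
    rw [← Equiv.prod_comp σ fun k => ((f ∘ σ.symm) k).1 (θ k)]; simp
  simp only [h4, h5]

/-- The norm of an antisymmetrized product vector. -/
lemma norm_projAntisymm_prodVec_sq_le (f : Fin n → ContL2) (β : Fin n → κ) :
    ‖projAntisymm n κ (prodVec f β)‖ ^ 2 ≤
      (n.factorial : ℝ)⁻¹ * ∏ k, ∫ x, ‖(f k).1 x‖ ^ 2 := by
  have h1 : ((‖projAntisymm n κ (prodVec f β)‖ ^ 2 : ℝ) : ℂ) =
      inner ℂ (prodVec f β) (projAntisymm n κ (prodVec f β)) := by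
    have h2 := Submodule.inner_starProjection_left_eq_right (antisymm n κ) (prodVec f β)
      (projAntisymm n κ (prodVec f β))
    have h3 : projAntisymm n κ (projAntisymm n κ (prodVec f β)) =
        projAntisymm n κ (prodVec f β) :=
      Submodule.starProjection_eq_self_iff.2 (projAntisymm_mem _)
    change inner ℂ (projAntisymm n κ (prodVec f β)) _ = inner ℂ _ (projAntisymm n κ _) at h2
    rw [h3] at h2
    rw [← h2, inner_self_eq_norm_sq_to_K]
    norm_cast
  -- Inner products of product vectors factorize, so the signed average is the Leibniz expansion of
  -- a Gram determinant of one-particle vectors.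
  have h4 : inner ℂ (prodVec f β) (projAntisymm n κ (prodVec f β)) =
      ((n.factorial : ℝ)⁻¹ : ℝ) * (Matrix.gram ℂ fun k => oneVec (f k) (β k)).det := by
    rw [projAntisymm_eq, inner_smul_right, inner_sum, Matrix.det_apply]
    push_cast
    congr 1
    refine Finset.sum_congr rfl fun σ _ => ?_
    rw [inner_smul_right, permL2_prodVec, inner_prodVec, ← Equiv.prod_comp σ]
    simp only [Matrix.gram_apply, Function.comp_apply, Equiv.symm_apply_apply]
    rw [Units.smul_def, zsmul_eq_mul]
  have h5 := congrArg Complex.re (h1.trans h4)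
  rw [Complex.ofReal_re, Complex.re_ofReal_mul] at h5
  rw [h5]
  refine mul_le_mul_of_nonneg_left ((re_det_gram_le _).trans_eq ?_) (by positivity)
  exact Finset.prod_congr rfl fun k _ => norm_oneVec_sq _ _

end ProductVectors

/-! ### Shifting contours in a tube -/

section ContourShift

variable {n : ℕ} {F : (Fin n → ℂ) → ℂ} {l b : Fin n → ℝ} {B : ℝ}

/-- Fubini, followed by translation invariance in `θ`, which removes the real displacement `t x •
b`. The uniform bound `B` supplies integrability on the product. -/
lemma integral_cpoint_average
    (hF : ∀ η ∈ Set.Icc (0 : ℝ) 1, ∀ θ, ContinuousAt F (cpoint (l + η • b) θ))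
    (hint : ∀ η ∈ Set.Icc (0 : ℝ) 1, Integrable fun θ => F (cpoint (l + η • b) θ))
    (hB : ∀ η ∈ Set.Icc (0 : ℝ) 1, ∫ θ, ‖F (cpoint (l + η • b) θ)‖ ≤ B)
    {y t : ℝ → ℝ} (hy : Continuous y) (ht : Continuous t)
    (hmem : ∀ x ∈ Set.Icc (0 : ℝ) 1, y x ∈ Set.Icc (0 : ℝ) 1) :
    Integrable (fun θ => ∫ x in (0 : ℝ)..1, F (cpoint (l + y x • b) (θ + t x • b))) ∧
      ∫ θ, ∫ x in (0 : ℝ)..1, F (cpoint (l + y x • b) (θ + t x • b)) =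
        ∫ x in (0 : ℝ)..1, ∫ θ, F (cpoint (l + y x • b) θ) := by
  let f : ℝ → (Fin n → ℝ) → ℂ := fun x θ => F (cpoint (l + y x • b) (θ + t x • b))
  have hcont : ContinuousOn (Function.uncurry f)
      (Set.Ioc (0 : ℝ) 1 ×ˢ (Set.univ : Set (Fin n → ℝ))) := by
    rintro ⟨x, θ⟩ ⟨hx, -⟩
    have hc : Continuous fun p : ℝ × (Fin n → ℝ) =>
        cpoint (l + y p.1 • b) (p.2 + t p.1 • b) := by
      unfold cpoint
      refine continuous_pi fun k => ?_
      simp only [Pi.add_apply, Pi.smul_apply]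
      fun_prop
    exact (ContinuousAt.comp (f := fun p : ℝ × (Fin n → ℝ) =>
        cpoint (l + y p.1 • b) (p.2 + t p.1 • b)) (x := (x, θ))
      (hF _ (hmem x (Set.Ioc_subset_Icc_self hx)) _) hc.continuousAt).continuousWithinAt
  have hmeas : AEStronglyMeasurable (Function.uncurry f)
      ((volume.restrict (Set.Ioc (0 : ℝ) 1)).prod volume) := by
    have := hcont.aestronglyMeasurable (μ := (volume : Measure ℝ).prod volume)
      (measurableSet_Ioc.prod MeasurableSet.univ)
    rwa [← Measure.prod_restrict, Measure.restrict_univ] at this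
  have hfi : ∀ x ∈ Set.Icc (0 : ℝ) 1, Integrable (f x) := fun x hx =>
    (hint _ (hmem x hx)).comp_add_right (t x • b)
  have hI : Integrable (Function.uncurry f)
      ((volume.restrict (Set.Ioc (0 : ℝ) 1)).prod volume) := by
    rw [integrable_prod_iff hmeas]
    constructor
    · filter_upwards [ae_restrict_mem measurableSet_Ioc] with x hx
      exact hfi x (Set.Ioc_subset_Icc_self hx)
    · refine Integrable.of_bound (C := B) hmeas.norm.integral_prod_right' ?_
      filter_upwards [ae_restrict_mem measurableSet_Ioc] with x hx
      rw [Real.norm_of_nonneg (integral_nonneg fun _ => norm_nonneg _)]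
      refine le_trans (le_of_eq ?_) (hB _ (hmem x (Set.Ioc_subset_Icc_self hx)))
      exact integral_add_right_eq_self (fun θ => ‖F (cpoint (l + y x • b) θ)‖) (t x • b)
  simp only [intervalIntegral.integral_of_le zero_le_one]
  refine ⟨hI.integral_prod_right, ?_⟩
  rw [← integral_integral_swap hI]
  refine integral_congr_ae (Filter.Eventually.of_forall fun x => ?_)
  exact integral_add_right_eq_self (fun θ => F (cpoint (l + y x • b) θ)) (t x • b)

/-- Shifting the domain of integration inside a tube. -/
lemma integral_cpoint_shift
    (hF : ∀ η ∈ Set.Icc (0 : ℝ) 1, ∀ θ, DifferentiableAt ℂ F (cpoint (l + η • b) θ))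
    (hint : ∀ η ∈ Set.Icc (0 : ℝ) 1, Integrable fun θ => F (cpoint (l + η • b) θ))
    (hB : ∀ η ∈ Set.Icc (0 : ℝ) 1, ∫ θ, ‖F (cpoint (l + η • b) θ)‖ ≤ B) :
    ∫ θ, F (cpoint l θ) = ∫ θ, F (cpoint (l + b) θ) := by
  have hFc : ∀ η ∈ Set.Icc (0 : ℝ) 1, ∀ θ, ContinuousAt F (cpoint (l + η • b) θ) :=
    fun η hη θ => (hF η hη θ).continuousAt
  have h01 : ∀ x ∈ Set.Icc (0 : ℝ) 1, (0 : ℝ) ∈ Set.Icc (0 : ℝ) 1 := fun _ _ => by simp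
  have h11 : ∀ x ∈ Set.Icc (0 : ℝ) 1, (1 : ℝ) ∈ Set.Icc (0 : ℝ) 1 := fun _ _ => by simp
  obtain ⟨i1, e1⟩ := integral_cpoint_average hFc hint hB (y := fun _ => 0) (t := fun x => x)
    continuous_const continuous_id h01
  obtain ⟨i2, e2⟩ := integral_cpoint_average hFc hint hB (y := fun _ => 1) (t := fun x => x)
    continuous_const continuous_id h11
  obtain ⟨i3, e3⟩ := integral_cpoint_average hFc hint hB (y := fun x => x) (t := fun _ => 1)
    continuous_id continuous_const fun _ h => h
  obtain ⟨i4, e4⟩ := integral_cpoint_average hFc hint hB (y := fun x => x) (t := fun _ => 0)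
    continuous_id continuous_const fun _ h => h
  -- Cauchy's theorem on the unit square for `ζ ↦ F (θ + i l + ζ b)`, with `θ` still free.
  have hrect : ∀ θ : Fin n → ℝ,
      (∫ x in (0 : ℝ)..1, F (cpoint (l + (0 : ℝ) • b) (θ + x • b))) -
        (∫ x in (0 : ℝ)..1, F (cpoint (l + (1 : ℝ) • b) (θ + x • b))) +
        Complex.I * (∫ y in (0 : ℝ)..1, F (cpoint (l + y • b) (θ + (1 : ℝ) • b))) -
        Complex.I * (∫ y in (0 : ℝ)..1, F (cpoint (l + y • b) (θ + (0 : ℝ) • b))) = 0 := by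
    intro θ
    let p : ℂ → (Fin n → ℂ) := fun ζ k => (θ k : ℂ) + Complex.I * (l k : ℂ) + ζ * (b k : ℂ)
    have hp : ∀ x y : ℝ, p (x + y * Complex.I) = cpoint (l + y • b) (θ + x • b) := by
      intro x y
      funext k
      simp only [p, cpoint, Pi.add_apply, Pi.smul_apply, smul_eq_mul]
      push_cast
      ring
    have hd : DifferentiableOn ℂ (fun ζ => F (p ζ)) (Set.uIcc (0 : ℂ).re (1 + Complex.I).re ×ℂ
        Set.uIcc (0 : ℂ).im (1 + Complex.I).im) := by
      intro ζ hζ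
      have h2 : ζ.im ∈ Set.Icc (0 : ℝ) 1 := by
        have := hζ.2
        simpa [Set.uIcc_of_le] using this
      have h3 : p ζ = cpoint (l + ζ.im • b) (θ + ζ.re • b) := by
        rw [← hp, Complex.re_add_im]
      have h4 : DifferentiableAt ℂ p ζ := by
        refine differentiableAt_pi.2 fun k => ?_
        simp only [p]
        fun_prop
      refine (DifferentiableAt.comp ζ ?_ h4).differentiableWithinAt
      rw [h3]
      exact hF _ h2 _
    have h := Complex.integral_boundary_rect_eq_zero_of_differentiableOn
      (fun ζ => F (p ζ)) 0 (1 + Complex.I) hd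
    have hq : ∀ y : ℝ, p (1 + y * Complex.I) = cpoint (l + y • b) (θ + (1 : ℝ) • b) := fun y => by
      rw [← hp]; norm_num
    have hq0 : ∀ y : ℝ, p (y * Complex.I) = cpoint (l + y • b) (θ + (0 : ℝ) • b) := fun y => by
      rw [← hp]; norm_num
    have hr : ∀ x : ℝ, p (x + Complex.I) = cpoint (l + (1 : ℝ) • b) (θ + x • b) := fun x => by
      rw [← hp]; norm_num
    have hr0 : ∀ x : ℝ, p x = cpoint (l + (0 : ℝ) • b) (θ + x • b) := fun x => by
      rw [← hp]; norm_num
    simp only [Complex.zero_re, Complex.zero_im, Complex.add_re, Complex.one_re, Complex.I_re,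
      Complex.add_im, Complex.one_im, Complex.I_im, add_zero, zero_add, Complex.ofReal_zero,
      Complex.ofReal_one, zero_mul, one_mul, smul_eq_mul, hq, hr, hr0, hq0] at h
    exact h
  have key : ∀ a₁ a₂ a₃ a₄ : (Fin n → ℝ) → ℂ, Integrable a₁ → Integrable a₂ → Integrable a₃ →
      Integrable a₄ → (∀ θ, a₁ θ - a₂ θ + Complex.I * a₃ θ - Complex.I * a₄ θ = 0) →
      (∫ θ, a₁ θ) - (∫ θ, a₂ θ) + Complex.I * (∫ θ, a₃ θ) - Complex.I * (∫ θ, a₄ θ) = 0 := by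
    intro a₁ a₂ a₃ a₄ j₁ j₂ j₃ j₄ h
    have j₁₂ : Integrable fun θ => a₁ θ - a₂ θ := j₁.sub j₂
    have j₁₃ : Integrable fun θ => a₁ θ - a₂ θ + Complex.I * a₃ θ := j₁₂.add (j₃.const_mul _)
    rw [← integral_const_mul, ← integral_const_mul, ← integral_sub j₁ j₂,
      ← integral_add j₁₂ (j₃.const_mul _), ← integral_sub j₁₃ (j₄.const_mul _)]
    simp only [h, integral_zero]
  have h := key _ _ _ _ i1 i2 i3 i4 hrect
  rw [e1, e2, e3, e4] at h
  -- After integration over `θ` the two vertical sides coincide and cancel, so no decay at infinity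
  -- is required.
  simp only [zero_smul, add_zero, one_smul, intervalIntegral.integral_const,
    sub_zero, add_sub_cancel_right] at h
  exact sub_eq_zero.1 h

end ContourShift

/-! ### Fourier inversion in coordinates -/

section Fourier

variable {n : ℕ}

/-- The character `θ ↦ exp(2πi q·θ)` of `ℝⁿ`. -/
noncomputable def expChar (q θ : Fin n → ℝ) : ℂ :=
  ∏ k, Complex.exp (2 * Real.pi * Complex.I * q k * θ k)

lemma expChar_eq (q θ : Fin n → ℝ) :
    expChar q θ = Complex.exp (((2 * Real.pi * ∑ k, q k * θ k : ℝ) : ℂ) * Complex.I) := by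
  rw [expChar, ← Complex.exp_sum, Finset.mul_sum]
  push_cast
  rw [Finset.sum_mul]
  congr 1
  exact Finset.sum_congr rfl fun k _ => by ring

lemma norm_expChar (q θ : Fin n → ℝ) : ‖expChar q θ‖ = 1 := by
  rw [expChar_eq, Complex.norm_exp_ofReal_mul_I]

lemma continuous_expChar : Continuous fun p : (Fin n → ℝ) × (Fin n → ℝ) => expChar p.1 p.2 := by
  unfold expChar
  fun_prop

/-- The Fourier transform on `ℝⁿ`. -/
noncomputable def fourierT (g : (Fin n → ℝ) → ℂ) (q : Fin n → ℝ) : ℂ :=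
  ∫ θ, expChar (-q) θ * g θ

/-- Transported from `EuclideanSpace`, whose coordinate map preserves volume. -/
lemma fourierT_inversion {g : (Fin n → ℝ) → ℂ} (hc : Continuous g) (hg : Integrable g)
    (hg' : Integrable (fourierT g)) (θ : Fin n → ℝ) :
    g θ = ∫ q, expChar q θ * fourierT g q := by
  let G : EuclideanSpace ℝ (Fin n) → ℂ := fun v => g v.ofLp
  have hv := PiLp.volume_preserving_ofLp (Fin n)
  have hemb : MeasurableEmbedding (WithLp.ofLp : EuclideanSpace ℝ (Fin n) → Fin n → ℝ) :=
    (MeasurableEquiv.toLp 2 (Fin n → ℝ)).symm.measurableEmbedding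
  have hin : ∀ v w : EuclideanSpace ℝ (Fin n), inner ℝ v w = ∑ k, w.ofLp k * v.ofLp k := by
    intro v w
    rw [PiLp.inner_apply]
    rfl
  have hFG : ∀ w : EuclideanSpace ℝ (Fin n),
      FourierTransform.fourier G w = fourierT g w.ofLp := by
    intro w
    rw [Real.fourier_eq', fourierT, ← hv.integral_comp hemb]
    refine integral_congr_ae (Filter.Eventually.of_forall fun v => ?_)
    simp only [G, expChar_eq, hin, smul_eq_mul, Pi.neg_apply, neg_mul, Finset.sum_neg_distrib,
      mul_neg]
  have h1 : Integrable G := (hv.integrable_comp_emb hemb).2 hg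
  have h2 : Integrable (FourierTransform.fourier G) := by
    have : FourierTransform.fourier G = fourierT g ∘ WithLp.ofLp := funext hFG
    rw [this]
    exact (hv.integrable_comp_emb hemb).2 hg'
  have hGc : Continuous G := hc.comp (PiLp.continuous_ofLp 2 _)
  have h3 := congrFun (hGc.fourierInv_fourier_eq h1 h2) (WithLp.toLp 2 θ)
  rw [Real.fourierInv_eq'] at h3
  refine h3.symm.trans ?_
  rw [← hv.integral_comp hemb]
  refine integral_congr_ae (Filter.Eventually.of_forall fun v => ?_)
  simp only [hFG, hin, expChar_eq, smul_eq_mul]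
  congr 5
  exact Finset.sum_congr rfl fun k _ => mul_comm _ _

end Fourier

/-! ### The weight `exp (-a cosh z)` on horizontal lines -/

section Cosh

lemma one_add_sq_div_two_le_cosh (x : ℝ) : 1 + x ^ 2 / 2 ≤ Real.cosh x := by
  have h0 : 0 ≤ |x| / 2 := by positivity
  have h1 := Real.self_le_sinh_iff.2 h0
  have h2 : Real.cosh x = 1 + 2 * Real.sinh (|x| / 2) ^ 2 := by
    rw [← Real.cosh_abs, show |x| = 2 * (|x| / 2) by ring, Real.cosh_two_mul, Real.cosh_sq]
    ring_nf
  rw [h2]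
  nlinarith [sq_abs x]

/-- The weight `exp(-a cosh z)`. -/
noncomputable def expCosh (a : ℝ) (z : ℂ) : ℂ := Complex.exp (-(a : ℂ) * Complex.cosh z)

lemma norm_expCosh (a x y : ℝ) :
    ‖expCosh a (x + Complex.I * y)‖ = Real.exp (-(a * Real.cosh x * Real.cos y)) := by
  rw [expCosh, Complex.norm_exp, mul_comm Complex.I, Complex.cosh_add, Complex.cosh_mul_I,
    Complex.sinh_mul_I, ← Complex.ofReal_cosh, ← Complex.ofReal_sinh, ← Complex.ofReal_cos,
    ← Complex.ofReal_sin]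
  simp [Complex.cos_ofReal_re]
  ring

lemma differentiable_expCosh (a : ℝ) : Differentiable ℂ (expCosh a) := by
  unfold expCosh
  fun_prop

/-- The modulus is `exp (-a cosh x cos y)`. Using `cosh x ≥ 1 + x² / 2` and `cos y ≥ cos c` leaves a
Gaussian in `x` and the decay `exp (-2 a₀ cos c)`. -/
lemma norm_expCosh_sq_le {a a₀ c x y : ℝ} (ha₀ : 0 < a₀) (ha : a₀ ≤ a) (hc0 : 0 ≤ c)
    (hc : c < Real.pi / 2) (hy : |y| ≤ c) :
    ‖expCosh a (x + Complex.I * y)‖ ^ 2 ≤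
      Real.exp (-(2 * a₀) * Real.cos c) * Real.exp (-(a₀ * Real.cos c) * x ^ 2) := by
  have hcos : 0 < Real.cos c := Real.cos_pos_of_mem_Ioo ⟨by linarith, hc⟩
  have hcos' : Real.cos c ≤ Real.cos y := by
    rw [← Real.cos_abs y]
    exact Real.cos_le_cos_of_nonneg_of_le_pi (abs_nonneg y) (by linarith [Real.pi_pos]) hy
  rw [norm_expCosh, ← Real.exp_nat_mul, ← Real.exp_add]
  refine Real.exp_le_exp.2 ?_
  have h1 : a₀ * (1 + x ^ 2 / 2) * Real.cos c ≤ a * Real.cosh x * Real.cos y := by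
    have := one_add_sq_div_two_le_cosh x
    have h3 : (0 : ℝ) < 1 + x ^ 2 / 2 := by positivity
    have h4 : 0 < a := ha₀.trans_le ha
    have h5 := Real.cosh_pos x
    gcongr
  push_cast
  nlinarith

lemma integrable_norm_expCosh_sq {a a₀ c y : ℝ} (ha₀ : 0 < a₀) (ha : a₀ ≤ a) (hc0 : 0 ≤ c)
    (hc : c < Real.pi / 2) (hy : |y| ≤ c) :
    Integrable (fun x : ℝ => ‖expCosh a (x + Complex.I * y)‖ ^ 2) ∧
      ∫ x : ℝ, ‖expCosh a (x + Complex.I * y)‖ ^ 2 ≤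
        Real.exp (-(2 * a₀) * Real.cos c) * √(Real.pi / (a₀ * Real.cos c)) := by
  have hcos : 0 < Real.cos c := Real.cos_pos_of_mem_Ioo ⟨by linarith, hc⟩
  have hi : Integrable fun x : ℝ =>
      Real.exp (-(2 * a₀) * Real.cos c) * Real.exp (-(a₀ * Real.cos c) * x ^ 2) :=
    (integrable_exp_neg_mul_sq (by positivity)).const_mul _
  have hcont : Continuous fun x : ℝ => ‖expCosh a (x + Complex.I * y)‖ ^ 2 := by
    have := (differentiable_expCosh a).continuous
    fun_prop
  have hle : ∀ x : ℝ, ‖expCosh a (x + Complex.I * y)‖ ^ 2 ≤ _ :=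
    fun x => norm_expCosh_sq_le ha₀ ha hc0 hc hy
  have h := hi.mono' hcont.aestronglyMeasurable
    (Filter.Eventually.of_forall fun x => by
      rw [Real.norm_of_nonneg (by positivity)]; exact hle x)
  refine ⟨h, (integral_mono h hi hle).trans_eq ?_⟩
  rw [integral_const_mul, integral_gaussian]

/-- The restriction of `exp(-a cosh z)` to the line `ℝ + i y`. -/
noncomputable def lineWeight {a y : ℝ} (ha : 0 < a) (hy : |y| < Real.pi / 2) : ContL2 :=
  ⟨fun x => expCosh a (x + Complex.I * y), by
    have := (differentiable_expCosh a).continuous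
    have hcont : Continuous fun x : ℝ => expCosh a (x + Complex.I * y) := by fun_prop
    exact ⟨hcont, (memLp_two_iff_integrable_sq_norm hcont.aestronglyMeasurable).2
      (integrable_norm_expCosh_sq ha le_rfl (abs_nonneg y) hy le_rfl).1⟩⟩

/-- Complex conjugation. -/
noncomputable def ContL2.conj (w : ContL2) : ContL2 :=
  ⟨fun x => (starRingEnd ℂ) (w.1 x), Complex.continuous_conj.comp w.2.1, w.2.2.star⟩

/-- Multiplication by `ρ exp(2πi q x)`. -/
noncomputable def ContL2.modulate (ρ q : ℝ) (w : ContL2) : ContL2 :=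
  ⟨fun x => ρ * Complex.exp (2 * Real.pi * Complex.I * q * x) * w.1 x, by
    have hcont : Continuous fun x : ℝ =>
        (ρ : ℂ) * Complex.exp (2 * Real.pi * Complex.I * q * x) * w.1 x := by
      have := w.2.1
      fun_prop
    refine ⟨hcont, (w.2.2.const_smul (ρ : ℂ)).mono hcont.aestronglyMeasurable
      (Filter.Eventually.of_forall fun x => ?_)⟩
    rw [norm_mul, norm_mul, show 2 * Real.pi * Complex.I * q * x =
      ((2 * Real.pi * q * x : ℝ) : ℂ) * Complex.I by push_cast; ring,
      Complex.norm_exp_ofReal_mul_I]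
    simp⟩

lemma ContL2.norm_modulate (ρ q : ℝ) (w : ContL2) (x : ℝ) :
    ‖(w.modulate ρ q).1 x‖ = |ρ| * ‖w.1 x‖ := by
  change ‖(ρ : ℂ) * Complex.exp (2 * Real.pi * Complex.I * q * x) * w.1 x‖ = _
  rw [norm_mul, norm_mul, show 2 * Real.pi * Complex.I * q * x =
      ((2 * Real.pi * q * x : ℝ) : ℂ) * Complex.I by push_cast; ring,
      Complex.norm_exp_ofReal_mul_I]
  simp

lemma ContL2.integral_norm_modulate_sq (ρ q : ℝ) (w : ContL2) :
    ∫ x, ‖(w.modulate ρ q).1 x‖ ^ 2 = ρ ^ 2 * ∫ x, ‖w.1 x‖ ^ 2 := by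
  rw [← integral_const_mul]
  simp only [ContL2.norm_modulate, mul_pow, sq_abs]

end Cosh

/-! ### Measurable families of modulated product vectors -/

section Measurability

variable {n : ℕ} {κ : Type*} [Fintype κ]

lemma norm_prodVec_sq (f : Fin n → ContL2) (β : Fin n → κ) :
    ‖prodVec f β‖ ^ 2 = ∏ k, ∫ x, ‖(f k).1 x‖ ^ 2 := by
  have h := inner_self_eq_norm_sq_to_K (𝕜 := ℂ) (prodVec f β)
  rw [inner_prodVec] at h
  simp only [inner_self_eq_norm_sq_to_K] at h
  have h1 : ((‖prodVec f β‖ ^ 2 : ℝ) : ℂ) =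
      ((∏ k, ‖oneVec (f k) (β k)‖ ^ 2 : ℝ) : ℂ) := by
    push_cast
    exact h.symm
  rw [Complex.ofReal_injective h1]
  exact Finset.prod_congr rfl fun k _ => norm_oneVec_sq _ _

lemma continuous_inner_oneVec_modulate (w : ContL2) (p : ℝ) (b : κ) :
    Continuous fun q : ℝ => inner ℂ (oneVec (w.modulate 1 p) b) (oneVec (w.modulate 1 q) b) := by
  classical
  simp only [inner_oneVec, if_true]
  refine continuous_of_dominated (bound := fun x => ‖w.1 x‖ ^ 2) (fun q => ?_) (fun q => ?_)
    ((memLp_two_iff_integrable_sq_norm w.2.2.1).1 w.2.2) ?_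
  · have h1 := (w.modulate 1 p).2.1
    have h2 := (w.modulate 1 q).2.1
    exact ((Complex.continuous_conj.comp h1).mul h2).aestronglyMeasurable
  · refine Filter.Eventually.of_forall fun x => ?_
    rw [norm_mul, RCLike.norm_conj, ContL2.norm_modulate, ContL2.norm_modulate]
    simp [sq]
  · refine Filter.Eventually.of_forall fun x => ?_
    simp only [ContL2.modulate]
    fun_prop

/-- The norm does not depend on `q`, so norm continuity at `p` follows from continuity of the inner
product with the vector at `p`. -/
lemma continuous_prodVec_modulate (w : Fin n → ContL2) (β : Fin n → κ) :
    Continuous fun q : Fin n → ℝ => prodVec (fun k => (w k).modulate 1 (q k)) β := by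
  rw [continuous_iff_continuousAt]
  intro p
  set A : (Fin n → ℝ) → L2 n κ := fun q => prodVec (fun k => (w k).modulate 1 (q k)) β with hA
  have hnorm : ∀ q, ‖A q‖ ^ 2 = ‖A p‖ ^ 2 := fun q => by
    simp only [hA, norm_prodVec_sq, ContL2.integral_norm_modulate_sq]
  have hin : Continuous fun q => inner ℂ (A p) (A q) := by
    simp only [hA, inner_prodVec]
    exact continuous_finsetProd _ fun k _ =>
      (continuous_inner_oneVec_modulate (w k) (p k) (β k)).comp (continuous_apply k)
  have hsq : ∀ q, ‖A q - A p‖ ^ 2 = 2 * (‖A p‖ ^ 2 - (inner ℂ (A p) (A q)).re) := fun q => by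
    rw [norm_sub_sq (𝕜 := ℂ), hnorm q, inner_re_symm]
    simp only [RCLike.re_to_complex]
    ring
  have hlim : Filter.Tendsto (fun q => ‖A q - A p‖ ^ 2) (nhds p) (nhds 0) := by
    have h1 : Continuous fun q => 2 * (‖A p‖ ^ 2 - (inner ℂ (A p) (A q)).re) :=
      continuous_const.mul (continuous_const.sub (Complex.continuous_re.comp hin))
    have h2 := h1.tendsto p
    simp only [← hsq, sub_self, norm_zero] at h2
    simpa using h2
  rw [ContinuousAt, tendsto_iff_norm_sub_tendsto_zero]
  have h3 := (Real.continuous_sqrt.tendsto 0).comp hlim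
  simp only [Function.comp_def, Real.sqrt_sq (norm_nonneg _), Real.sqrt_zero] at h3
  exact h3

/-- Separates the amplitudes `ρ`, which will only be measurable, from the norm continuous family of
amplitude one. -/
lemma prodVec_modulate (w : Fin n → ContL2) (ρ q : Fin n → ℝ) (β : Fin n → κ) :
    prodVec (fun k => (w k).modulate (ρ k) (q k)) β =
      ((∏ k, ρ k : ℝ) : ℂ) • prodVec (fun k => (w k).modulate 1 (q k)) β := by
  classical
  refine Lp.ext ?_
  filter_upwards [prodVec_ae (fun k => (w k).modulate (ρ k) (q k)) β,
    prodVec_ae (fun k => (w k).modulate 1 (q k)) β,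
    Lp.coeFn_smul ((∏ k, ρ k : ℝ) : ℂ) (prodVec (fun k => (w k).modulate 1 (q k)) β)]
    with θ h1 h2 h3
  rw [h1, h3, Pi.smul_apply, h2]
  ext α
  simp only [prodFun, PiLp.smul_apply, PiLp.single_apply, ContL2.modulate]
  split_ifs
  · push_cast
    rw [smul_eq_mul, ← Finset.prod_mul_distrib]
    exact Finset.prod_congr rfl fun k _ => by ring
  · simp

lemma memLp_prodVec_modulate (w : Fin n → ContL2) {ρ : Fin n → ℝ → ℝ}
    (hρ : ∀ k, Measurable (ρ k)) (hρ2 : ∀ k, Integrable fun t => ρ k t ^ 2) (β : Fin n → κ) :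
    MemLp (fun q : Fin n → ℝ =>
      prodVec (fun k => (w k).modulate (ρ k (q k)) (q k)) β) 2 volume := by
  have h1 : Measurable fun q : Fin n → ℝ => ((∏ k, ρ k (q k) : ℝ) : ℂ) :=
    Complex.measurable_ofReal.comp
      (Finset.measurable_prod _ fun k _ => (hρ k).comp (measurable_pi_apply k))
  have hmeas : AEStronglyMeasurable (fun q : Fin n → ℝ =>
      prodVec (fun k => (w k).modulate (ρ k (q k)) (q k)) β) volume := by
    have h3 : (fun q : Fin n → ℝ => prodVec (fun k => (w k).modulate (ρ k (q k)) (q k)) β) =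
        fun q => ((∏ k, ρ k (q k) : ℝ) : ℂ) • prodVec (fun k => (w k).modulate 1 (q k)) β :=
      funext fun q => prodVec_modulate w (fun k => ρ k (q k)) q β
    rw [h3]
    exact h1.aestronglyMeasurable.smul (continuous_prodVec_modulate w β).aestronglyMeasurable
  rw [memLp_two_iff_integrable_sq_norm hmeas]
  simp only [norm_prodVec_sq, ContL2.integral_norm_modulate_sq, Finset.prod_mul_distrib]
  exact (Integrable.fintype_prod (μ := fun _ : Fin n => (volume : Measure ℝ)) hρ2).mul_const _

lemma memLp_projAntisymm_prodVec_modulate (w : Fin n → ContL2) {ρ : Fin n → ℝ → ℝ}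
    (hρ : ∀ k, Measurable (ρ k)) (hρ2 : ∀ k, Integrable fun t => ρ k t ^ 2) (β : Fin n → κ) :
    MemLp (fun q : Fin n → ℝ =>
      projAntisymm n κ (prodVec (fun k => (w k).modulate (ρ k (q k)) (q k)) β)) 2 volume :=
  (projAntisymm n κ).comp_memLp' (memLp_prodVec_modulate w hρ hρ2 β)

/-- The Hadamard bound holds for each `q` and carries the factor `1 / n!`; what remains is a product
of functions of the single `q k`. -/
lemma integral_norm_projAntisymm_prodVec_modulate_le (w : Fin n → ContL2) {ρ : Fin n → ℝ → ℝ}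
    (hρ : ∀ k, Measurable (ρ k)) (hρ2 : ∀ k, Integrable fun t => ρ k t ^ 2) (β : Fin n → κ)
    {N M : ℝ} (hN : ∀ k, ∫ x, ‖(w k).1 x‖ ^ 2 ≤ N) (hM : ∀ k, ∫ t, ρ k t ^ 2 = M) :
    ∫ q : Fin n → ℝ,
      ‖projAntisymm n κ (prodVec (fun k => (w k).modulate (ρ k (q k)) (q k)) β)‖ ^ 2 ≤
        (n.factorial : ℝ)⁻¹ * (N ^ n * M ^ n) := by
  have hL := memLp_projAntisymm_prodVec_modulate w hρ hρ2 β
  set A : (Fin n → ℝ) → L2 n κ := fun q =>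
    projAntisymm n κ (prodVec (fun k => (w k).modulate (ρ k (q k)) (q k)) β) with hA
  have hbound : ∀ q, ‖A q‖ ^ 2 ≤ (n.factorial : ℝ)⁻¹ * (N ^ n * ∏ k, ρ k (q k) ^ 2) := by
    intro q
    refine (norm_projAntisymm_prodVec_sq_le _ β).trans ?_
    refine mul_le_mul_of_nonneg_left ?_ (by positivity)
    simp only [ContL2.integral_norm_modulate_sq]
    rw [Finset.prod_mul_distrib, mul_comm]
    refine mul_le_mul_of_nonneg_right ?_ (Finset.prod_nonneg fun k _ => by positivity)
    refine (Finset.prod_le_prod (fun k _ => integral_nonneg fun x => by positivity)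
      fun k _ => hN k).trans_eq ?_
    simp
  have hint : Integrable fun q : Fin n → ℝ =>
      (n.factorial : ℝ)⁻¹ * (N ^ n * ∏ k, ρ k (q k) ^ 2) :=
    ((Integrable.fintype_prod (μ := fun _ : Fin n => (volume : Measure ℝ)) hρ2).const_mul
      _).const_mul _
  refine (integral_mono ((memLp_two_iff_integrable_sq_norm hL.1).1 hL) hint hbound).trans_eq ?_
  rw [integral_const_mul, integral_const_mul,
    integral_fintype_prod_volume_eq_prod fun k t => ρ k t ^ 2]
  simp [hM]

end Measurability

/-! ### Exponential factors on half-lines -/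

section HalfLine

open Classical in
/-- The square root of `exp(-2πc|q|)`, restricted to `q ≤ 0` or `q > 0`. -/
noncomputable def halfExp (c : ℝ) (b : Bool) (q : ℝ) : ℝ :=
  if b = decide (q ≤ 0) then Real.exp (-(Real.pi * c * |q|)) else 0

lemma measurable_halfExp (c : ℝ) (b : Bool) : Measurable (halfExp c b) := by
  refine Measurable.ite ?_ (by fun_prop) measurable_const
  cases b
  · have : {q : ℝ | false = decide (q ≤ 0)} = Set.Ioi 0 := by ext q; simp
    rw [this]; exact measurableSet_Ioi
  · have : {q : ℝ | true = decide (q ≤ 0)} = Set.Iic 0 := by ext q; simp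
    rw [this]; exact measurableSet_Iic

lemma halfExp_sq_integral {c : ℝ} (hc : 0 < c) (b : Bool) :
    Integrable (fun q => halfExp c b q ^ 2) ∧
      ∫ q, halfExp c b q ^ 2 = (2 * Real.pi * c)⁻¹ := by
  have hpc : 0 < 2 * Real.pi * c := by positivity
  cases b
  · have : (fun q => halfExp c false q ^ 2) =
        (Set.Ioi (0 : ℝ)).indicator fun q => Real.exp (-(2 * Real.pi * c) * q) := by
      funext q
      by_cases hq : q ≤ 0
      · simp [halfExp, hq]
      · have hq' : 0 < q := not_le.1 hq
        simp only [halfExp, hq, decide_false, if_true, Set.indicator_of_mem (Set.mem_Ioi.2 hq'),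
          abs_of_pos hq', ← Real.exp_nat_mul]
        congr 1; push_cast; ring
    rw [this, integral_indicator measurableSet_Ioi, integrable_indicator_iff measurableSet_Ioi,
      integral_exp_mul_Ioi (by linarith)]
    refine ⟨integrableOn_exp_mul_Ioi (by linarith) 0, ?_⟩
    simp
  · have : (fun q => halfExp c true q ^ 2) =
        (Set.Iic (0 : ℝ)).indicator fun q => Real.exp (2 * Real.pi * c * q) := by
      funext q
      by_cases hq : q ≤ 0
      · simp only [halfExp, hq, decide_true, if_true, Set.indicator_of_mem (Set.mem_Iic.2 hq),
          abs_of_nonpos hq, ← Real.exp_nat_mul]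
        congr 1; push_cast; ring
      · simp [halfExp, hq]
    rw [this, integral_indicator measurableSet_Iic, integrable_indicator_iff measurableSet_Iic,
      integral_exp_mul_Iic hpc]
    refine ⟨integrableOn_exp_mul_Iic hpc 0, ?_⟩
    simp

end HalfLine

/-! ### Antisymmetrizing functionals and vectors together -/

section Symmetrization

variable {n : ℕ} {κ κ' : Type*} [Fintype κ] [Fintype κ']

lemma inner_mul_integrable {S : Type*} [MeasurableSpace S] {μ : Measure S} {Y Z : Type*}
    [NormedAddCommGroup Y] [InnerProductSpace ℂ Y] [NormedAddCommGroup Z] [InnerProductSpace ℂ Z]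
    {v : S → Z} {y : S → Y} (hv : MemLp v 2 μ) (hy : MemLp y 2 μ) (z : Z) (φ : Y) :
    Integrable (fun t => inner ℂ (v t) z * inner ℂ φ (y t)) μ :=
  MemLp.integrable_mul (hv.inner_const z) (hy.const_inner φ)

/-- A sum of rank one operators which is invariant under simultaneous permutations may be
antisymmetrized on both sides. -/
lemma sum_integral_projAntisymm (u : κ → ℝ → ContL2) (w : κ → ℝ → ContL2) (r : κ → κ')
    (hu : ∀ β : Fin n → κ, MemLp (fun q : Fin n → ℝ => prodVec (fun k => u (β k) (q k)) β) 2 volume)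
    (hw : ∀ β : Fin n → κ,
      MemLp (fun q : Fin n → ℝ => prodVec (fun k => w (β k) (q k)) (r ∘ β)) 2 volume)
    (z : L2 n κ) (φ : L2 n κ') :
    ∑ β : Fin n → κ, ∫ q : Fin n → ℝ, inner ℂ (prodVec (fun k => u (β k) (q k)) β) z *
        inner ℂ (projAntisymm n κ' φ) (prodVec (fun k => w (β k) (q k)) (r ∘ β)) =
      ∑ β : Fin n → κ, ∫ q : Fin n → ℝ,
        inner ℂ (projAntisymm n κ (prodVec (fun k => u (β k) (q k)) β)) z *
        inner ℂ φ (projAntisymm n κ' (prodVec (fun k => w (β k) (q k)) (r ∘ β))) := by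
  set ψ := projAntisymm n κ' φ with hψ
  have hψm : ψ ∈ antisymm n κ' := projAntisymm_mem φ
  have hψi : ∀ y : L2 n κ', inner ℂ φ (projAntisymm n κ' y) = inner ℂ ψ y := fun y =>
    (Submodule.inner_starProjection_left_eq_right (antisymm n κ') φ y).symm
  have hn : (n.factorial : ℂ) ≠ 0 := Nat.cast_ne_zero.2 n.factorial_ne_zero
  let f : (Fin n → κ) → (Fin n → ℝ) → ℂ := fun β q =>
    inner ℂ (prodVec (fun k => u (β k) (q k)) β) z *
      inner ℂ ψ (prodVec (fun k => w (β k) (q k)) (r ∘ β))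
  have hf : ∀ β, Integrable (f β) := fun β => inner_mul_integrable (hu β) (hw β) z ψ
  -- Since `ψ` is antisymmetric, the sign of each permutation acting on the left factor is absorbed
  -- by applying the same permutation to the right factor. No symmetry of `z` is involved.
  have hterm : ∀ β q, inner ℂ (projAntisymm n κ (prodVec (fun k => u (β k) (q k)) β)) z *
      inner ℂ ψ (prodVec (fun k => w (β k) (q k)) (r ∘ β)) =
      (n.factorial : ℂ)⁻¹ * ∑ σ : Equiv.Perm (Fin n), f (β ∘ σ.symm) (q ∘ σ.symm) := by
    intro β q
    rw [projAntisymm_eq, inner_smul_left, sum_inner, map_inv₀, map_natCast, mul_assoc,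
      Finset.sum_mul]
    congr 1
    refine Finset.sum_congr rfl fun σ _ => ?_
    have h1 : inner ℂ ψ (permL2 σ (prodVec (fun k => w (β k) (q k)) (r ∘ β))) =
        ((Equiv.Perm.sign σ : ℤ) : ℂ) *
          inner ℂ ψ (prodVec (fun k => w (β k) (q k)) (r ∘ β)) := by
      rw [← inner_conj_symm, permL2_inner_antisymm σ _ hψm, map_mul, inner_conj_symm, map_intCast]
    rw [inner_smul_left, map_intCast]
    rw [show ((Equiv.Perm.sign σ : ℤ) : ℂ) *
      inner ℂ (permL2 σ (prodVec (fun k => u (β k) (q k)) β)) z *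
      inner ℂ ψ (prodVec (fun k => w (β k) (q k)) (r ∘ β)) =
      inner ℂ (permL2 σ (prodVec (fun k => u (β k) (q k)) β)) z *
      (((Equiv.Perm.sign σ : ℤ) : ℂ) *
      inner ℂ ψ (prodVec (fun k => w (β k) (q k)) (r ∘ β))) by ring, ← h1,
      permL2_prodVec, permL2_prodVec]
    rfl
  simp only [hψi, hterm]
  -- A simultaneous permutation of labels and frequencies only reparametrizes the sum and the
  -- integral, so all `n!` terms of the average agree.
  have hinv : ∀ σ : Equiv.Perm (Fin n),
      ∑ β, ∫ q : Fin n → ℝ, f (β ∘ σ.symm) (q ∘ σ.symm) = ∑ β, ∫ q, f β q := by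
    intro σ
    rw [← Equiv.sum_comp (Equiv.arrowCongr σ (Equiv.refl κ)) fun β => ∫ q, f β q]
    refine Finset.sum_congr rfl fun β _ => ?_
    exact integral_perm σ.symm fun q => f (β ∘ σ.symm) q
  have hfσ : ∀ (σ : Equiv.Perm (Fin n)) β, Integrable fun q : Fin n → ℝ =>
      f (β ∘ σ.symm) (q ∘ σ.symm) := fun σ β =>
    ((measurePreserving_perm σ.symm).integrable_comp_emb (measurableEmbedding_perm σ.symm)).2
      (hf (β ∘ σ.symm))
  have hsum : ∀ β, ∫ q, (n.factorial : ℂ)⁻¹ * ∑ σ : Equiv.Perm (Fin n),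
      f (β ∘ σ.symm) (q ∘ σ.symm) =
      (n.factorial : ℂ)⁻¹ * ∑ σ : Equiv.Perm (Fin n), ∫ q, f (β ∘ σ.symm) (q ∘ σ.symm) :=
    fun β => by
      rw [integral_const_mul, integral_finsetSum _ fun σ _ => hfσ σ β]
  simp only [hsum]
  rw [← Finset.mul_sum, Finset.sum_comm, Finset.sum_congr rfl fun σ _ => hinv σ]
  simp [Fintype.card_perm, hn, f]

end Symmetrization

/-! ### Slices at the corners of a cube -/

section Slices

variable {n : ℕ} {ι : Type*} [Fintype ι] {C : Set (Fin n → ℝ)}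

/-- The imaginary displacements `(±c, …, ±c)`. -/
def cornerShift (c : ℝ) (ε : Fin n → Bool) : Fin n → ℝ := fun k => if ε k then c else -c

/-- The vector of all slices at the corners of a cube, as a function on `ℝⁿ`. -/
noncomputable def cornerFun (c : ℝ) (h : (Fin n → ℂ) → TensorK n ι) (θ : Fin n → ℝ) :
    TensorK n (ι × Bool) :=
  WithLp.toLp 2 fun β =>
    h (cpoint (lamHalfPi n + cornerShift c (fun k => (β k).2)) θ) (fun k => (β k).1)

lemma norm_cornerFun_sq (c : ℝ) (h : (Fin n → ℂ) → TensorK n ι) (θ : Fin n → ℝ) :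
    ‖cornerFun c h θ‖ ^ 2 =
      ∑ ε : Fin n → Bool, ‖h (cpoint (lamHalfPi n + cornerShift c ε) θ)‖ ^ 2 := by
  simp only [EuclideanSpace.norm_sq_eq]
  rw [← (Equiv.arrowProdEquivProdArrow (Fin n) (fun _ => ι) (fun _ => Bool)).symm.sum_comp,
    Fintype.sum_prod_type_right]
  rfl

lemma memLp_cornerFun {c : ℝ} (hc : ∀ ε : Fin n → Bool, lamHalfPi n + cornerShift c ε ∈ C)
    (h : Hardy C (TensorK n ι)) : MemLp (cornerFun c h) 2 volume := by
  have hcont : Continuous (cornerFun c h) := by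
    refine (PiLp.continuous_toLp 2 _).comp (continuous_pi fun β => ?_)
    exact (EuclideanSpace.proj (𝕜 := ℂ) _).continuous.comp (continuous_slice h.2.1 (hc _))
  rw [memLp_two_iff_integrable_sq_norm hcont.aestronglyMeasurable]
  simp only [norm_cornerFun_sq]
  exact integrable_finsetSum _ fun ε _ =>
    (memLp_two_iff_integrable_sq_norm (h.memLp (hc ε)).1).1 (h.memLp (hc ε))

/-- The squared norm is a sum over `2 ^ n` corners, each slice contributing at most `‖h‖ ^ 2`. -/
lemma norm_toLp_cornerFun_le {c : ℝ}
    (hc : ∀ ε : Fin n → Bool, lamHalfPi n + cornerShift c ε ∈ C) (h : Hardy C (TensorK n ι)) :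
    ‖(memLp_cornerFun hc h).toLp _‖ ≤ √(2 ^ n) * ‖h‖ := by
  refine le_of_sq_le_sq ?_ (by positivity)
  rw [norm_toLp_sq, mul_pow, Real.sq_sqrt (by positivity)]
  simp only [norm_cornerFun_sq]
  rw [integral_finsetSum _ fun ε _ =>
    (memLp_two_iff_integrable_sq_norm (h.memLp (hc ε)).1).1 (h.memLp (hc ε))]
  have h1 : ∀ ε : Fin n → Bool,
      ∫ θ, ‖h (cpoint (lamHalfPi n + cornerShift c ε) θ)‖ ^ 2 ≤ ‖h‖ ^ 2 := by
    intro ε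
    have h2 := h.sliceNorm_le (hc ε)
    rw [sliceNorm, toReal_eLpNorm_two (h.memLp (hc ε))] at h2
    rw [← Real.sq_sqrt (integral_nonneg fun θ => by positivity :
      0 ≤ ∫ θ, ‖h (cpoint (lamHalfPi n + cornerShift c ε) θ)‖ ^ 2)]
    exact pow_le_pow_left₀ (Real.sqrt_nonneg _) h2 2
  refine (Finset.sum_le_sum fun ε _ => h1 ε).trans_eq ?_
  simp

/-- The map assigning to `h` its slices at the corners of a cube. -/
noncomputable def cornerSlices {c : ℝ}
    (hc : ∀ ε : Fin n → Bool, lamHalfPi n + cornerShift c ε ∈ C) :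
    Hardy C (TensorK n ι) →L[ℂ] L2 n (ι × Bool) :=
  LinearMap.mkContinuous
    { toFun := fun h => (memLp_cornerFun hc h).toLp _
      map_add' := fun h g => by
        rw [← MemLp.toLp_add]
        rfl
      map_smul' := fun a h => by
        rw [RingHom.id_apply, ← MemLp.toLp_const_smul]
        rfl }
    (√(2 ^ n)) (norm_toLp_cornerFun_le hc)

lemma norm_cornerSlices_le {c : ℝ}
    (hc : ∀ ε : Fin n → Bool, lamHalfPi n + cornerShift c ε ∈ C) :
    ‖cornerSlices (ι := ι) hc‖ ≤ √(2 ^ n) :=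
  LinearMap.mkContinuous_norm_le _ (Real.sqrt_nonneg _) _

lemma cornerSlices_ae {c : ℝ}
    (hc : ∀ ε : Fin n → Bool, lamHalfPi n + cornerShift c ε ∈ C) (h : Hardy C (TensorK n ι)) :
    cornerSlices hc h =ᵐ[volume] cornerFun c h := (memLp_cornerFun hc h).coeFn_toLp

end Slices

/-! ### Weighted slices and their Fourier transforms -/

section WeightedSlices

variable {n : ℕ} {ι : Type*}

/-- The weight `∏ₖ exp(-a_{αₖ} cosh(θₖ + i lₖ))`. -/
noncomputable def coshWeight (a : ι → ℝ) (α : Fin n → ι) (l θ : Fin n → ℝ) : ℂ :=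
  ∏ k, expCosh (a (α k)) (θ k + Complex.I * l k)

variable {a : ι → ℝ} {a₀ c : ℝ}

lemma memLp_coshWeight (ha : ∀ i, 0 < a i) (α : Fin n → ι) {l : Fin n → ℝ}
    (hl : ∀ k, |l k| < Real.pi / 2) : MemLp (coshWeight a α l) 2 volume :=
  memLp_prod (fun k => (lineWeight (ha (α k)) (hl k)).2.1)
    fun k => (lineWeight (ha (α k)) (hl k)).2.2

lemma continuous_coshWeight (a : ι → ℝ) (α : Fin n → ι) (l : Fin n → ℝ) :
    Continuous (coshWeight a α l) := by
  refine continuous_finsetProd _ fun k _ => ?_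
  have := (differentiable_expCosh (a (α k))).continuous
  fun_prop

/-- The bound on the square norm of the weight in one variable. -/
noncomputable def coshBound (a₀ c : ℝ) : ℝ :=
  Real.exp (-(2 * a₀) * Real.cos c) * √(Real.pi / (a₀ * Real.cos c))

lemma integral_norm_coshWeight_sq_le (ha₀ : 0 < a₀) (ha : ∀ i, a₀ ≤ a i) (hc0 : 0 ≤ c)
    (hc : c < Real.pi / 2) (α : Fin n → ι) {l : Fin n → ℝ} (hl : ∀ k, |l k| ≤ c) :
    ∫ θ, ‖coshWeight a α l θ‖ ^ 2 ≤ coshBound a₀ c ^ n := by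
  simp only [coshWeight, norm_prod, ← Finset.prod_pow]
  rw [integral_fintype_prod_volume_eq_prod
    fun k (x : ℝ) => ‖expCosh (a (α k)) (x + Complex.I * l k)‖ ^ 2]
  refine (Finset.prod_le_prod (fun k _ => integral_nonneg fun x => by positivity) fun k _ =>
    (integrable_norm_expCosh_sq ha₀ (ha (α k)) hc0 hc (hl k)).2).trans_eq ?_
  simp [coshBound]

variable [Fintype ι] {C : Set (Fin n → ℝ)}

/-- The component `α` of the slice at `(-π/2, …, -π/2) + l`, multiplied by the weight. -/
noncomputable def weightedSlice (a : ι → ℝ) (h : (Fin n → ℂ) → TensorK n ι) (α : Fin n → ι)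
    (l θ : Fin n → ℝ) : ℂ :=
  coshWeight a α l θ * h (cpoint (lamHalfPi n + l) θ) α

lemma memLp_slice_component (h : Hardy C (TensorK n ι)) {l : Fin n → ℝ}
    (hl : lamHalfPi n + l ∈ C) (α : Fin n → ι) :
    MemLp (fun θ => h (cpoint (lamHalfPi n + l) θ) α) 2 volume :=
  (EuclideanSpace.proj (𝕜 := ℂ) α).comp_memLp' (h.memLp hl)

lemma integrable_weightedSlice (ha : ∀ i, 0 < a i) (h : Hardy C (TensorK n ι)) (α : Fin n → ι)
    {l : Fin n → ℝ} (hlC : lamHalfPi n + l ∈ C) (hl : ∀ k, |l k| < Real.pi / 2) :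
    Integrable (weightedSlice a h α l) :=
  MemLp.integrable_mul (memLp_coshWeight ha α hl) (memLp_slice_component h hlC α)

lemma continuous_weightedSlice (h : Hardy C (TensorK n ι)) (α : Fin n → ι)
    {l : Fin n → ℝ} (hlC : lamHalfPi n + l ∈ C) : Continuous (weightedSlice a h α l) :=
  (continuous_coshWeight a α l).mul
    ((EuclideanSpace.proj (𝕜 := ℂ) α).continuous.comp (continuous_slice h.2.1 hlC))

/-- Cauchy–Schwarz between weight and slice. The bound is uniform in `l`, as the contour shift
demands. -/
lemma integral_norm_weightedSlice_le (ha₀ : 0 < a₀) (ha : ∀ i, a₀ ≤ a i) (hc0 : 0 ≤ c)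
    (hc : c < Real.pi / 2) (h : Hardy C (TensorK n ι)) (α : Fin n → ι)
    {l : Fin n → ℝ} (hlC : lamHalfPi n + l ∈ C) (hl : ∀ k, |l k| ≤ c) :
    ∫ θ, ‖weightedSlice a h α l θ‖ ≤ √(coshBound a₀ c ^ n) * ‖h‖ := by
  have h1 : MemLp (coshWeight a α l) 2 volume :=
    memLp_coshWeight (fun i => ha₀.trans_le (ha i)) α fun k => (hl k).trans_lt hc
  have h2 := memLp_slice_component h hlC α
  have h3 : ∫ θ, ‖weightedSlice a h α l θ‖ ≤ (eLpNorm (coshWeight a α l) 2 volume).toReal *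
      (eLpNorm (fun θ => h (cpoint (lamHalfPi n + l) θ) α) 2 volume).toReal := by
    change ∫ θ, ‖(coshWeight a α l • fun θ => h (cpoint (lamHalfPi n + l) θ) α) θ‖ ≤ _
    rw [integral_norm_eq_lintegral_enorm (h1.1.smul h2.1), ← ENNReal.toReal_mul,
      ← eLpNorm_one_eq_lintegral_enorm]
    exact ENNReal.toReal_mono (ENNReal.mul_ne_top h1.2.ne h2.2.ne)
      (eLpNorm_smul_le_mul_eLpNorm h2.1 h1.1)
  refine h3.trans (mul_le_mul ?_ ?_ ENNReal.toReal_nonneg (Real.sqrt_nonneg _))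
  · rw [toReal_eLpNorm_two h1]
    exact Real.sqrt_le_sqrt (integral_norm_coshWeight_sq_le ha₀ ha hc0 hc α hl)
  · refine le_trans ?_ (h.sliceNorm_le hlC)
    exact ENNReal.toReal_mono (h.memLp hlC).2.ne
      (eLpNorm_mono fun θ => PiLp.norm_apply_le _ α)

/-- Shifting the contour in the Fourier transform of a weighted slice. -/
lemma fourierT_weightedSlice (ha₀ : 0 < a₀) (ha : ∀ i, a₀ ≤ a i) (hc0 : 0 ≤ c)
    (hc : c < Real.pi / 2) (hC : ∀ l : Fin n → ℝ, (∀ k, |l k| ≤ c) → lamHalfPi n + l ∈ C)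
    (h : Hardy C (TensorK n ι)) (α : Fin n → ι) {l : Fin n → ℝ} (hl : ∀ k, |l k| ≤ c)
    (q : Fin n → ℝ) :
    fourierT (weightedSlice a h α 0) q =
      ((∏ k, Real.exp (2 * Real.pi * q k * l k) : ℝ) : ℂ) *
        fourierT (weightedSlice a h α l) q := by
  have ha' : ∀ i, 0 < a i := fun i => ha₀.trans_le (ha i)
  -- The Fourier integrand continued to the tube. Character and weight are centred at the base
  -- point, so that real arguments correspond to the slice at `lamHalfPi n`.
  let F : (Fin n → ℂ) → ℂ := fun z =>
    (∏ k, Complex.exp (-(2 * Real.pi * Complex.I * q k * (z k - Complex.I * lamHalfPi n k))) *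
      expCosh (a (α k)) (z k - Complex.I * lamHalfPi n k)) * h z α
  have hval : ∀ l θ, F (cpoint (lamHalfPi n + l) θ) =
      ((∏ k, Real.exp (2 * Real.pi * q k * l k) : ℝ) : ℂ) *
        (expChar (-q) θ * weightedSlice a h α l θ) := by
    intro l θ
    have h1 : ∀ k, cpoint (lamHalfPi n + l) θ k - Complex.I * lamHalfPi n k =
        θ k + Complex.I * l k := fun k => by
      simp only [cpoint, Pi.add_apply]; push_cast; ring
    have h2 : ∀ k, Complex.exp (-(2 * Real.pi * Complex.I * q k * (θ k + Complex.I * l k))) =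
        ((Real.exp (2 * Real.pi * q k * l k) : ℝ) : ℂ) *
          Complex.exp (2 * Real.pi * Complex.I * ((-q) k : ℝ) * θ k) := fun k => by
      rw [Complex.ofReal_exp, ← Complex.exp_add]
      congr 1
      simp only [Pi.neg_apply]
      push_cast
      ring_nf
      rw [Complex.I_sq]
      ring
    simp only [F, h1, h2, weightedSlice, coshWeight, expChar, Finset.prod_mul_distrib]
    push_cast
    ring
  have hηl : ∀ η ∈ Set.Icc (0 : ℝ) 1, ∀ k, |(η • l) k| ≤ c := fun η hη k => by
    rw [Pi.smul_apply, smul_eq_mul, abs_mul, abs_of_nonneg hη.1]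
    exact (mul_le_of_le_one_left (abs_nonneg _) hη.2).trans (hl k)
  have hint : ∀ l : Fin n → ℝ, (∀ k, |l k| ≤ c) →
      Integrable fun θ => F (cpoint (lamHalfPi n + l) θ) := by
    intro l hl
    simp only [hval]
    refine Integrable.const_mul ?_ _
    have h1 := integrable_weightedSlice ha' h α (hC l hl) fun k => (hl k).trans_lt hc
    refine h1.mono ?_ (Filter.Eventually.of_forall fun θ => by rw [norm_mul, norm_expChar, one_mul])
    have h2 : Continuous fun θ => expChar (-q) θ :=
      continuous_expChar.comp (continuous_const.prodMk continuous_id)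
    exact h2.aestronglyMeasurable.mul h1.1
  -- For fixed `q` the continued character grows at most like `exp (2π|q k|c)` in each variable,
  -- uniformly on the cube.
  have hB : ∀ l : Fin n → ℝ, (∀ k, |l k| ≤ c) → ∫ θ, ‖F (cpoint (lamHalfPi n + l) θ)‖ ≤
      (∏ k, Real.exp (2 * Real.pi * |q k| * c)) * (√(coshBound a₀ c ^ n) * ‖h‖) := by
    intro l hl
    simp only [hval, norm_mul, norm_expChar, one_mul]
    rw [integral_const_mul]
    refine mul_le_mul ?_ (integral_norm_weightedSlice_le ha₀ ha hc0 hc h α (hC l hl) hl)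
      (integral_nonneg fun _ => norm_nonneg _) (Finset.prod_nonneg fun _ _ => (Real.exp_pos _).le)
    rw [Complex.norm_real, norm_prod]
    refine Finset.prod_le_prod (fun _ _ => norm_nonneg _) fun k _ => ?_
    rw [Real.norm_of_nonneg (Real.exp_pos _).le]
    refine Real.exp_le_exp.2 ?_
    have h1 : q k * l k ≤ |q k| * c := (le_abs_self _).trans (by
      rw [abs_mul]; exact mul_le_mul_of_nonneg_left (hl k) (abs_nonneg _))
    have := Real.pi_pos
    nlinarith
  have key := integral_cpoint_shift (F := F) (l := lamHalfPi n) (b := l)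
    (fun η hη θ => by
      have hz : cpoint (lamHalfPi n + η • l) θ ∈ tube C :=
        cpoint_mem_tube (hC _ (hηl η hη)) θ
      have h1 : DifferentiableAt ℂ (fun z => h z α) (cpoint (lamHalfPi n + η • l) θ) :=
        (EuclideanSpace.proj (𝕜 := ℂ) α).differentiableAt.comp _ (h.2.1 _ hz).differentiableAt
      refine DifferentiableAt.fun_mul ?_ h1
      have h2 : Differentiable ℂ fun z : Fin n → ℂ => ∏ k,
          Complex.exp (-(2 * Real.pi * Complex.I * q k * (z k - Complex.I * lamHalfPi n k))) *
            expCosh (a (α k)) (z k - Complex.I * lamHalfPi n k) := by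
        have h3 : ∀ k, Differentiable ℂ (expCosh (a (α k))) :=
          fun k => differentiable_expCosh (a (α k))
        classical
        refine fun z => (HasFDerivAt.finsetProd (u := Finset.univ) fun k _ =>
          DifferentiableAt.hasFDerivAt ?_).differentiableAt
        fun_prop
      exact h2 _)
    (fun η hη => hint _ (hηl η hη)) (fun η hη => hB _ (hηl η hη))
  have h0 : ∀ θ, F (cpoint (lamHalfPi n) θ) = expChar (-q) θ * weightedSlice a h α 0 θ := by
    intro θ
    have := hval 0 θ
    simpa using this
  simp only [h0, hval] at key
  rw [integral_const_mul] at key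
  exact key

/-- On the orthant labelled by `ε` the corner satisfies `q k * l k = -c|q k|`, so the factor of the
contour shift is the square of `halfExp`. Outside it some `halfExp` vanishes. -/
lemma prod_halfExp_sq_mul_fourierT (ha₀ : 0 < a₀) (ha : ∀ i, a₀ ≤ a i) (hc0 : 0 ≤ c)
    (hc : c < Real.pi / 2) (hC : ∀ l : Fin n → ℝ, (∀ k, |l k| ≤ c) → lamHalfPi n + l ∈ C)
    (h : Hardy C (TensorK n ι)) (α : Fin n → ι) (ε : Fin n → Bool) (q : Fin n → ℝ) :
    ((∏ k, halfExp c (ε k) (q k) : ℝ) : ℂ) ^ 2 *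
        fourierT (weightedSlice a h α (cornerShift c ε)) q =
      Set.indicator {q | ε = fun k => decide (q k ≤ 0)}
        (fourierT (weightedSlice a h α 0)) q := by
  by_cases hε : ε = fun k => decide (q k ≤ 0)
  · rw [Set.indicator_of_mem (by exact hε), fourierT_weightedSlice ha₀ ha hc0 hc hC h α
      (l := cornerShift c ε) (fun k => by
        simp only [cornerShift]; split_ifs <;> simp [abs_of_nonneg hc0])]
    congr 1
    rw [← Complex.ofReal_pow, ← Finset.prod_pow]
    congr 1
    refine Finset.prod_congr rfl fun k _ => ?_
    have hk : ε k = decide (q k ≤ 0) := congrFun hε k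
    rw [halfExp, if_pos hk, ← Real.exp_nat_mul]
    congr 1
    simp only [cornerShift, hk]
    by_cases h0 : q k ≤ 0
    · simp only [h0, decide_true, if_true, abs_of_nonpos h0]
      push_cast; ring
    · simp only [h0, decide_false, abs_of_pos (not_le.1 h0)]
      push_cast; simp; ring
  · rw [Set.indicator_of_notMem (by exact hε)]
    obtain ⟨k, hk⟩ := Function.ne_iff.1 hε
    rw [Finset.prod_eq_zero (Finset.mem_univ k) (by rw [halfExp, if_neg hk])]
    simp

lemma continuous_fourierT {g : (Fin n → ℝ) → ℂ} (hg : Integrable g) :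
    Continuous (fourierT g) := by
  have hc : ∀ q : Fin n → ℝ, Continuous fun θ => expChar (-q) θ := fun q =>
    continuous_expChar.comp (continuous_const.prodMk continuous_id)
  refine continuous_of_dominated (bound := fun θ => ‖g θ‖)
    (fun q => (hc q).aestronglyMeasurable.mul hg.1) (fun q => ?_) hg.norm ?_
  · exact Filter.Eventually.of_forall fun θ => by rw [norm_mul, norm_expChar, one_mul]
  · refine Filter.Eventually.of_forall fun θ => Continuous.mul ?_ continuous_const
    simp only [expChar, Pi.neg_apply]
    fun_prop

lemma norm_fourierT_le (g : (Fin n → ℝ) → ℂ) (q : Fin n → ℝ) :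
    ‖fourierT g q‖ ≤ ∫ θ, ‖g θ‖ := by
  refine (norm_integral_le_integral_norm _).trans_eq ?_
  simp only [norm_mul, norm_expChar, one_mul]

/-- On the orthant containing `q` the shifted transform is bounded, which leaves the decay `∏ exp
(-2πc|q k|)`. The sum of the two half-line factors in each variable is an integrable majorant for
all orthants at once. -/
lemma integrable_fourierT_weightedSlice (ha₀ : 0 < a₀) (ha : ∀ i, a₀ ≤ a i) (hc0 : 0 < c)
    (hc : c < Real.pi / 2) (hC : ∀ l : Fin n → ℝ, (∀ k, |l k| ≤ c) → lamHalfPi n + l ∈ C)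
    (h : Hardy C (TensorK n ι)) (α : Fin n → ι) :
    Integrable (fourierT (weightedSlice a h α 0)) := by
  have ha' : ∀ i, 0 < a i := fun i => ha₀.trans_le (ha i)
  have h0 := integrable_weightedSlice ha' h α (hC 0 fun k => by simpa using hc0.le)
    fun k => by simpa using hc0.trans hc
  have h1 : Integrable fun q : Fin n → ℝ =>
      (∏ k, (halfExp c true (q k) ^ 2 + halfExp c false (q k) ^ 2)) *
        (√(coshBound a₀ c ^ n) * ‖h‖) :=
    (Integrable.fintype_prod (μ := fun _ : Fin n => (volume : Measure ℝ)) fun _ =>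
      (halfExp_sq_integral hc0 true).1.add (halfExp_sq_integral hc0 false).1).mul_const _
  refine h1.mono' (continuous_fourierT h0).aestronglyMeasurable
    (Filter.Eventually.of_forall fun q => ?_)
  set ε : Fin n → Bool := fun k => decide (q k ≤ 0) with hε
  have hl : ∀ k, |cornerShift c ε k| ≤ c := fun k => by
    simp only [cornerShift]; split_ifs <;> simp [abs_of_nonneg hc0.le]
  have h2 := prod_halfExp_sq_mul_fourierT ha₀ ha hc0.le hc hC h α ε q
  rw [Set.indicator_of_mem (by exact hε)] at h2
  rw [← h2, norm_mul]
  refine mul_le_mul ?_ ((norm_fourierT_le _ _).trans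
    (integral_norm_weightedSlice_le ha₀ ha hc0.le hc h α (hC _ hl) hl)) (norm_nonneg _)
    (Finset.prod_nonneg fun k _ => by positivity)
  rw [norm_pow, Complex.norm_real, Real.norm_eq_abs, sq_abs, ← Finset.prod_pow]
  refine Finset.prod_le_prod (fun k _ => by positivity) fun k _ => ?_
  cases ε k <;> nlinarith [sq_nonneg (halfExp c true (q k)), sq_nonneg (halfExp c false (q k))]

end WeightedSlices

/-! ### The operator as an integral of rank one operators -/

section Formula

variable {n : ℕ} {ι : Type*} {a : ι → ℝ} {c : ℝ}

lemma abs_corner_lt (hc0 : 0 < c) (hc : c < Real.pi / 2) (b : Bool) :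
    |if b then c else -c| < Real.pi / 2 := by
  cases b <;> simpa [abs_of_pos hc0] using hc

/-- The one variable factors of the functionals in the decomposition of the operator. -/
noncomputable def leftFactor (ha : ∀ i, 0 < a i) (hc0 : 0 < c) (hc : c < Real.pi / 2)
    (b : ι × Bool) : ContL2 :=
  (lineWeight (ha b.1) (abs_corner_lt hc0 hc b.2)).conj

/-- The one variable factors of the vectors in the decomposition of the operator. -/
noncomputable def rightFactor (ha : ∀ i, 0 < a i) (b : ι × Bool) : ContL2 :=
  lineWeight (y := 0) (ha b.1) (by simpa using half_pos Real.pi_pos)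

/-- A bilinear form of the Parseval identity. -/
lemma integral_mul_fourier_inversion {g u : (Fin n → ℝ) → ℂ} (hgc : Continuous g)
    (hg : Integrable g) (hg' : Integrable (fourierT g)) (hu : Integrable u) :
    ∫ θ, u θ * g θ = ∫ q, fourierT g q * ∫ θ, u θ * expChar q θ := by
  have hI : Integrable (Function.uncurry fun (θ q : Fin n → ℝ) =>
      u θ * (expChar q θ * fourierT g q)) (volume.prod volume) := by
    have h1 : Integrable (fun p : (Fin n → ℝ) × (Fin n → ℝ) => u p.1 * fourierT g p.2)
        (volume.prod volume) := hu.mul_prod hg'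
    refine h1.mono ?_ (Filter.Eventually.of_forall fun p => ?_)
    · have h2 : Continuous fun p : (Fin n → ℝ) × (Fin n → ℝ) => expChar p.2 p.1 := by
        unfold expChar
        fun_prop
      refine (h2.aestronglyMeasurable.mul h1.1).congr (Filter.Eventually.of_forall fun p => ?_)
      simp only [Function.uncurry, Pi.mul_apply]
      ring
    · simp only [Function.uncurry, norm_mul, norm_expChar, one_mul, le_refl]
  have h1 : ∀ θ, u θ * g θ = ∫ q, u θ * (expChar q θ * fourierT g q) := fun θ => by
    rw [integral_const_mul, ← fourierT_inversion hgc hg hg']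
  simp only [h1]
  rw [integral_integral_swap hI]
  refine integral_congr_ae (Filter.Eventually.of_forall fun q => ?_)
  simp only
  rw [← integral_const_mul]
  refine integral_congr_ae (Filter.Eventually.of_forall fun θ => ?_)
  simp only
  ring

/-- The even splitting of the weight: one factor stays with the slice of `h`, the other will enter
`rightVec`. -/
lemma xFun_apply (m : ι → ℝ) (s : ℝ) (h : (Fin n → ℂ) → TensorK n ι) (θ : Fin n → ℝ)
    (α : Fin n → ι) :
    xFun m s h θ α = coshWeight (fun i => s * m i / 4) α 0 θ *
      weightedSlice (fun i => s * m i / 4) h α 0 θ := by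
  rw [weightedSlice, ← mul_assoc, coshWeight, ← Finset.prod_mul_distrib, add_zero]
  change ((∏ k, Real.exp (-(s / 2) * m (α k) * Real.cosh (θ k)) : ℝ) : ℂ) * _ = _
  rw [Complex.ofReal_prod]
  congr 1
  refine Finset.prod_congr rfl fun k _ => ?_
  simp only [expCosh, Pi.zero_apply, Complex.ofReal_zero, mul_zero, add_zero, ← Complex.exp_add]
  push_cast
  congr 1
  ring

variable [Fintype ι]

/-- The product vectors defining the functionals. -/
noncomputable def leftVec (ha : ∀ i, 0 < a i) (hc0 : 0 < c) (hc : c < Real.pi / 2)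
    (β : Fin n → ι × Bool) (q : Fin n → ℝ) : L2 n (ι × Bool) :=
  prodVec (fun k => (leftFactor ha hc0 hc (β k)).modulate (halfExp c (β k).2 (q k)) (q k)) β

/-- The product vectors in the range space. -/
noncomputable def rightVec (ha : ∀ i, 0 < a i) (c : ℝ)
    (β : Fin n → ι × Bool) (q : Fin n → ℝ) : L2 n ι :=
  prodVec (fun k => (rightFactor ha (β k)).modulate (halfExp c (β k).2 (q k)) (q k))
    (Prod.fst ∘ β)

variable {C : Set (Fin n → ℝ)}

/-- Antilinearity in the first slot undoes the conjugation in `leftFactor` and turns the modulation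
by `q` into the Fourier kernel at `-q`. -/
lemma inner_leftVec (ha : ∀ i, 0 < a i) (hc0 : 0 < c) (hc : c < Real.pi / 2)
    (hC : ∀ ε : Fin n → Bool, lamHalfPi n + cornerShift c ε ∈ C) (h : Hardy C (TensorK n ι))
    (β : Fin n → ι × Bool) (q : Fin n → ℝ) :
    inner ℂ (leftVec ha hc0 hc β q) (cornerSlices hC h) =
      ((∏ k, halfExp c (β k).2 (q k) : ℝ) : ℂ) *
        fourierT (weightedSlice a h (fun k => (β k).1) (cornerShift c fun k => (β k).2)) q := by
  rw [L2.inner_def, fourierT, ← integral_const_mul]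
  refine integral_congr_ae ?_
  filter_upwards [prodVec_ae (fun k => (leftFactor ha hc0 hc (β k)).modulate
    (halfExp c (β k).2 (q k)) (q k)) β, cornerSlices_ae hC h] with θ h1 h2
  rw [leftVec, h1, h2, inner_prodFun_left, cornerFun, weightedSlice,
    coshWeight, expChar, ← mul_assoc, ← mul_assoc, Complex.ofReal_prod,
    ← Finset.prod_mul_distrib, ← Finset.prod_mul_distrib, map_prod]
  congr 1
  refine Finset.prod_congr rfl fun k _ => ?_
  simp only [leftFactor, ContL2.modulate, ContL2.conj, lineWeight, map_mul, Complex.conj_conj,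
    Complex.conj_ofReal, ← Complex.exp_conj, Complex.conj_I, map_ofNat, Pi.neg_apply, cornerShift]
  congr 3
  push_cast
  ring

lemma inner_rightVec (ha : ∀ i, 0 < a i) (φ : L2 n ι) (β : Fin n → ι × Bool) (q : Fin n → ℝ) :
    inner ℂ φ (rightVec ha c β q) =
      ((∏ k, halfExp c (β k).2 (q k) : ℝ) : ℂ) *
        ∫ θ, (starRingEnd ℂ) (φ θ fun k => (β k).1) *
          coshWeight a (fun k => (β k).1) 0 θ * expChar q θ := by
  rw [L2.inner_def, ← integral_const_mul]
  refine integral_congr_ae ?_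
  filter_upwards [prodVec_ae (fun k => (rightFactor ha (β k)).modulate
    (halfExp c (β k).2 (q k)) (q k)) (Prod.fst ∘ β)] with θ h1
  rw [rightVec, h1, inner_prodFun_right, coshWeight, expChar,
    mul_comm, mul_assoc, mul_left_comm]
  congr 1
  rw [Complex.ofReal_prod, ← Finset.prod_mul_distrib, ← Finset.prod_mul_distrib]
  refine Finset.prod_congr rfl fun k _ => ?_
  simp only [rightFactor, ContL2.modulate, lineWeight, Pi.zero_apply, Complex.ofReal_zero]
  ring

lemma memLp_leftVec (ha : ∀ i, 0 < a i) (hc0 : 0 < c) (hc : c < Real.pi / 2)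
    (β : Fin n → ι × Bool) : MemLp (leftVec ha hc0 hc β) 2 volume :=
  memLp_prodVec_modulate _ (fun _ => measurable_halfExp c _)
    (fun _ => (halfExp_sq_integral hc0 _).1) β

lemma memLp_rightVec (ha : ∀ i, 0 < a i) (hc0 : 0 < c)
    (β : Fin n → ι × Bool) : MemLp (rightVec ha c β) 2 volume :=
  memLp_prodVec_modulate _ (fun _ => measurable_halfExp c _)
    (fun _ => (halfExp_sq_integral hc0 _).1) _

/-- The operator `X` as an integral of rank one operators. -/
lemma inner_opX {m : ι → ℝ} (hm : ∀ i, 0 < m i) {s : ℝ} (hs : 0 < s) {m₀ : ℝ} (hm₀ : 0 < m₀)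
    (hmm : ∀ i, m₀ ≤ m i) (ha : ∀ i, 0 < s * m i / 4) (hc0 : 0 < c) (hc : c < Real.pi / 2)
    (hCube : ∀ l : Fin n → ℝ, (∀ k, |l k| ≤ c) → lamHalfPi n + l ∈ C)
    (hC : ∀ ε : Fin n → Bool, lamHalfPi n + cornerShift c ε ∈ C)
    (hl : lamHalfPi n ∈ C) (h : Hardy C (TensorK n ι)) (φ : L2 n ι) :
    inner ℂ φ (opX hm hs hl h) = ∑ β : Fin n → ι × Bool, ∫ q,
      inner ℂ (leftVec ha hc0 hc β q) (cornerSlices hC h) * inner ℂ φ (rightVec ha c β q) := by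
  have ha₀ : 0 < s * m₀ / 4 := by positivity
  have haa : ∀ i, s * m₀ / 4 ≤ s * m i / 4 := fun i => by
    have := hmm i
    gcongr
  set a : ι → ℝ := fun i => s * m i / 4 with hadef
  let u : (Fin n → ι) → (Fin n → ℝ) → ℂ := fun α θ =>
    (starRingEnd ℂ) (φ θ α) * coshWeight a α 0 θ
  have hl0 : ∀ k, |(0 : Fin n → ℝ) k| < Real.pi / 2 := fun k => by simpa using hc0.trans hc
  have hC0 : lamHalfPi n + (0 : Fin n → ℝ) ∈ C := by simpa using hl
  have hφ : ∀ α, MemLp (fun θ => φ θ α) 2 volume := fun α =>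
    (EuclideanSpace.proj (𝕜 := ℂ) α).comp_memLp' (Lp.memLp φ)
  have hu : ∀ α, Integrable (u α) := fun α =>
    MemLp.integrable_mul (hφ α).star (memLp_coshWeight ha α hl0)
  have hLHS : inner ℂ φ (opX hm hs hl h) =
      ∑ α, ∫ θ, u α θ * weightedSlice a h α 0 θ := by
    have hint : ∀ α ∈ Finset.univ, Integrable fun θ => u α θ * weightedSlice a h α 0 θ := by
      intro α _
      have h1 : MemLp (fun θ => xFun m s h θ α) 2 volume :=
        (EuclideanSpace.proj (𝕜 := ℂ) α).comp_memLp' (memLp_xFun hm hs hl h)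
      have h2 : Integrable fun θ => (starRingEnd ℂ) (φ θ α) * xFun m s h θ α :=
        MemLp.integrable_mul (hφ α).star h1
      refine h2.congr (Filter.Eventually.of_forall fun θ => ?_)
      simp only [xFun_apply, u, hadef]
      ring
    rw [L2.inner_def, ← integral_finsetSum _ hint]
    refine integral_congr_ae ?_
    filter_upwards [opX_apply hm hs hl h] with θ h1
    rw [h1, PiLp.inner_apply]
    refine Finset.sum_congr rfl fun α _ => ?_
    rw [xFun_apply, RCLike.inner_apply]
    simp only [u, hadef]
    ring
  have hG : ∀ α, Integrable (fourierT (weightedSlice a h α 0)) := fun α =>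
    integrable_fourierT_weightedSlice ha₀ haa hc0 hc hCube h α
  have hparseval : ∀ α, ∫ θ, u α θ * weightedSlice a h α 0 θ =
      ∫ q, fourierT (weightedSlice a h α 0) q * ∫ θ, u α θ * expChar q θ := fun α =>
    integral_mul_fourier_inversion (continuous_weightedSlice h α hC0)
      (integrable_weightedSlice ha h α hC0 hl0) (hG α) (hu α)
  let f : (Fin n → ι) → (Fin n → ℝ) → ℂ := fun α q =>
    fourierT (weightedSlice a h α 0) q * ∫ θ, u α θ * expChar q θ
  -- The `halfExp` factors of the two vectors multiply to the full factor of the contour shift,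
  -- which restores the unshifted transform on one orthant.
  have hterm : ∀ (β : Fin n → ι × Bool) q,
      inner ℂ (leftVec ha hc0 hc β q) (cornerSlices hC h) * inner ℂ φ (rightVec ha c β q) =
      Set.indicator {q : Fin n → ℝ | (fun k => (β k).2) = fun k => decide (q k ≤ 0)}
        (f fun k => (β k).1) q := by
    intro β q
    rw [inner_leftVec, inner_rightVec, Set.indicator_mul_left,
      ← prod_halfExp_sq_mul_fourierT ha₀ haa hc0.le hc hCube h]
    ring
  have hindint : ∀ (α : Fin n → ι) (ε : Fin n → Bool), Integrable
      (Set.indicator {q : Fin n → ℝ | ε = fun k => decide (q k ≤ 0)} (f α)) := by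
    intro α ε
    have h1 := inner_mul_integrable (memLp_leftVec (n := n) ha hc0 hc fun k => (α k, ε k))
      (memLp_rightVec (n := n) ha hc0 fun k => (α k, ε k)) (cornerSlices hC h) φ
    simp only [hterm] at h1
    exact h1
  rw [hLHS]
  simp only [hterm, hparseval]
  rw [← (Equiv.arrowProdEquivProdArrow (Fin n) (fun _ => ι) (fun _ => Bool)).symm.sum_comp,
    Fintype.sum_prod_type]
  refine Finset.sum_congr rfl fun α _ => ?_
  change ∫ q, f α q = ∑ ε : Fin n → Bool,
    ∫ q, Set.indicator {q : Fin n → ℝ | ε = fun k => decide (q k ≤ 0)} (f α) q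
  rw [← integral_finsetSum _ fun ε _ => hindint α ε]
  -- Every `q`, coordinate hyperplanes included, lies in exactly one labelled orthant.
  refine integral_congr_ae (Filter.Eventually.of_forall fun q => ?_)
  simp only [Set.indicator_apply, Set.mem_ofPred_eq]
  rw [Finset.sum_ite_eq' Finset.univ (fun k => decide (q k ≤ 0))]
  simp

end Formula

/-! ### The cube inside the polyhedron -/

section Geometry

variable {n : ℕ} {C : Set (Fin n → ℝ)}

/-- A point outside `C` within distance `c` would bound the distance to the complement by `c`; that
distance is attained on the frontier, which is farther away. -/
lemma mem_of_abs_lt_boundaryDist (hC : lamHalfPi n ∈ C) {c : ℝ}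
    (hc0 : 0 ≤ c) (hc : c < boundaryDist C) (l : Fin n → ℝ) (hl : ∀ k, |l k| ≤ c) :
    lamHalfPi n + l ∈ C := by
  by_contra hx
  obtain ⟨y, hy, hyd⟩ := exists_mem_frontier_infDist_compl_eq_dist hC
    fun h => hx (h ▸ Set.mem_univ _)
  have h1 : boundaryDist C ≤ dist (lamHalfPi n) y := Metric.infDist_le_dist_of_mem hy
  have h2 : Metric.infDist (lamHalfPi n) Cᶜ ≤ dist (lamHalfPi n) (lamHalfPi n + l) :=
    Metric.infDist_le_dist_of_mem hx
  have h3 : dist (lamHalfPi n) (lamHalfPi n + l) ≤ c := by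
    rw [dist_self_add_right]
    exact (pi_norm_le_iff_of_nonneg hc0).2 hl
  linarith

lemma boundaryDist_pos (hn : 1 ≤ n) (hopen : IsOpen C) (hC : lamHalfPi n ∈ C)
    (hsub : C ⊆ Set.univ.pi fun _ => Set.Ioo (-Real.pi) 0) : 0 < boundaryDist C := by
  -- `Metric.infDist` to the empty set is zero, so the frontier must be shown nonempty. The origin
  -- lies outside `C` because `n ≥ 1`.
  have hne : (frontier C).Nonempty := by
    rw [Set.nonempty_iff_ne_empty, Ne, frontier_eq_empty_iff]
    rintro (h | h)
    · rw [h] at hC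
      exact hC
    · have h0 : (0 : Fin n → ℝ) ∈ C := h ▸ Set.mem_univ _
      exact lt_irrefl _ (hsub h0 ⟨0, hn⟩ (Set.mem_univ _)).2
  refine (isClosed_frontier.notMem_iff_infDist_pos hne).1 ?_
  rw [hopen.frontier_eq]
  exact fun h => h.2 hC

end Geometry

/-! ### Collecting the constants -/

section Bound

variable {n : ℕ} {ι : Type*} [Fintype ι] {C : Set (Fin n → ℝ)}

/-- The constant per variable: `√2` from the norm of `cornerSlices`, `coshBound` from the weights,
and `(2πc)⁻¹` from the integral of `halfExp ^ 2`. -/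
lemma coshBound_eq {s m₀ c : ℝ} (hs : 0 < s) (hm₀ : 0 < m₀) (hc0 : 0 < c)
    (hc : c < Real.pi / 2) :
    √2 * coshBound (s * m₀ / 4) c * (2 * Real.pi * c)⁻¹ =
      1 / √(Real.pi / 2 * m₀) *
        (Real.exp (-(s * m₀ / 2) * Real.cos c) / (c * √(s * Real.cos c))) := by
  have hcos : 0 < Real.cos c := Real.cos_pos_of_mem_Ioo ⟨by linarith, hc⟩
  have hpi := Real.pi_pos
  have h1 : √2 * √(Real.pi / (s * m₀ / 4 * Real.cos c)) * √(Real.pi / 2 * m₀) *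
      √(s * Real.cos c) = 2 * Real.pi := by
    rw [← Real.sqrt_mul (by positivity), ← Real.sqrt_mul (by positivity),
      ← Real.sqrt_mul (by positivity), ← Real.sqrt_sq (by positivity : 0 ≤ 2 * Real.pi)]
    congr 1
    field_simp
    ring
  have h2 : 0 < √(Real.pi / 2 * m₀) := Real.sqrt_pos.2 (by positivity)
  have h3 : 0 < √(s * Real.cos c) := Real.sqrt_pos.2 (by positivity)
  rw [coshBound, show 2 * (s * m₀ / 4) = s * m₀ / 2 by ring]
  rw [inv_eq_one_div, div_mul_div_comm, mul_one_div, div_eq_div_iff (by positivity) (by positivity)]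
  linear_combination (Real.exp (-(s * m₀ / 2) * Real.cos c) * c) * h1

lemma nuclear_projAntisymm_opX {m : ι → ℝ} (hm : ∀ i, 0 < m i) {s : ℝ} (hs : 0 < s)
    {m₀ : ℝ} (hm₀ : 0 < m₀) (hmm : ∀ i, m₀ ≤ m i) {c : ℝ} (hc0 : 0 < c)
    (hc : c < Real.pi / 2) (hCube : ∀ l : Fin n → ℝ, (∀ k, |l k| ≤ c) → lamHalfPi n + l ∈ C)
    (hl : lamHalfPi n ∈ C) :
    IsNuclear ((projAntisymm n ι).comp (opX hm hs hl)) ∧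
      nuclearNorm ((projAntisymm n ι).comp (opX hm hs hl)) ≤
        (2 : ℝ) ^ n / (n.factorial : ℝ) *
          ((Fintype.card ι : ℝ) / √(Real.pi / 2 * m₀) *
            (Real.exp (-(s * m₀ / 2) * Real.cos c) / (c * √(s * Real.cos c)))) ^ n := by
  have ha : ∀ i, 0 < s * m i / 4 := fun i => by have := hm i; positivity
  have ha₀ : 0 < s * m₀ / 4 := by positivity
  have haa : ∀ i, s * m₀ / 4 ≤ s * m i / 4 := fun i => by
    have := hmm i
    gcongr
  have hC : ∀ ε : Fin n → Bool, lamHalfPi n + cornerShift c ε ∈ C := fun ε =>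
    hCube _ fun k => by simp only [cornerShift]; split_ifs <;> simp [abs_of_pos hc0]
  have hleft : ∀ b : ι × Bool, ∫ x, ‖(leftFactor ha hc0 hc b).1 x‖ ^ 2 ≤
      coshBound (s * m₀ / 4) c := by
    intro b
    have h1 : ∀ x, ‖(leftFactor ha hc0 hc b).1 x‖ =
        ‖expCosh (s * m b.1 / 4) (x + Complex.I * ((if b.2 then c else -c : ℝ) : ℂ))‖ :=
      fun x => RCLike.norm_conj _
    simp only [h1]
    exact (integrable_norm_expCosh_sq ha₀ (haa b.1) hc0.le hc
      (by split_ifs <;> simp [abs_of_pos hc0])).2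
  have hright : ∀ b : ι × Bool, ∫ x, ‖(rightFactor ha b).1 x‖ ^ 2 ≤
      coshBound (s * m₀ / 4) c := fun b =>
    (integrable_norm_expCosh_sq (y := 0) ha₀ (haa b.1) hc0.le hc (by simpa using hc0.le)).2
  have hT : ∀ h φ, inner ℂ φ ((projAntisymm n ι).comp (opX hm hs hl) h) =
      ∑ β : Fin n → ι × Bool, ∫ q,
        inner ℂ (projAntisymm n (ι × Bool) (leftVec ha hc0 hc β q)) (cornerSlices hC h) *
          inner ℂ φ (projAntisymm n ι (rightVec ha c β q)) := by
    intro h φ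
    have h1 : inner ℂ φ ((projAntisymm n ι).comp (opX hm hs hl) h) =
        inner ℂ (projAntisymm n ι φ) (opX hm hs hl h) :=
      (Submodule.inner_starProjection_left_eq_right (antisymm n ι) φ _).symm
    rw [h1, inner_opX hm hs hm₀ hmm ha hc0 hc hCube hC]
    exact sum_integral_projAntisymm
      (fun b t => (leftFactor ha hc0 hc b).modulate (halfExp c b.2 t) t)
      (fun b t => (rightFactor ha b).modulate (halfExp c b.2 t) t) Prod.fst
      (memLp_leftVec ha hc0 hc) (memLp_rightVec ha hc0) _ _
  obtain ⟨h1, h2⟩ := nuclear_of_integral_rank_one _ (cornerSlices hC)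
    (fun β => (projAntisymm n (ι × Bool)).comp_memLp' (memLp_leftVec ha hc0 hc β))
    (fun β => (projAntisymm n ι).comp_memLp' (memLp_rightVec ha hc0 β)) hT
  refine ⟨h1, h2.trans ?_⟩
  set N := coshBound (s * m₀ / 4) c with hN
  set M := (2 * Real.pi * c)⁻¹ with hM
  have hN0 : 0 ≤ N := by rw [hN, coshBound]; positivity
  have hM0 : 0 ≤ M := by rw [hM]; have := Real.pi_pos; positivity
  -- Both square roots have the same bound, each with a factor `1 / √n!`; together they give `1 /
  -- n!`.
  have hK : ∀ β : Fin n → ι × Bool, ‖cornerSlices (ι := ι) hC‖ *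
      (√(∫ q, ‖projAntisymm n (ι × Bool) (leftVec ha hc0 hc β q)‖ ^ 2) *
        √(∫ q, ‖projAntisymm n ι (rightVec ha c β q)‖ ^ 2)) ≤
      √(2 ^ n) * ((n.factorial : ℝ)⁻¹ * (N ^ n * M ^ n)) := by
    intro β
    have hl' := integral_norm_projAntisymm_prodVec_modulate_le
      (fun k => leftFactor ha hc0 hc (β k)) (ρ := fun k => halfExp c (β k).2)
      (fun _ => measurable_halfExp c _) (fun _ => (halfExp_sq_integral hc0 _).1) β
      (fun k => hleft (β k)) (fun k => (halfExp_sq_integral hc0 (β k).2).2)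
    have hr' := integral_norm_projAntisymm_prodVec_modulate_le
      (fun k => rightFactor ha (β k)) (ρ := fun k => halfExp c (β k).2)
      (fun _ => measurable_halfExp c _) (fun _ => (halfExp_sq_integral hc0 _).1) (Prod.fst ∘ β)
      (fun k => hright (β k)) (fun k => (halfExp_sq_integral hc0 (β k).2).2)
    refine mul_le_mul (norm_cornerSlices_le hC) ?_ (by positivity) (by positivity)
    refine (mul_le_mul (Real.sqrt_le_sqrt hl') (Real.sqrt_le_sqrt hr') (Real.sqrt_nonneg _)
      (Real.sqrt_nonneg _)).trans_eq (Real.mul_self_sqrt (by positivity))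
  -- There are `(2 * card ι) ^ n` labels `β`; this is the origin of `2 ^ n` and of the dimension
  -- factor.
  refine (Finset.sum_le_sum fun β _ => hK β).trans_eq ?_
  have hsq : √((2 : ℝ) ^ n) = √2 ^ n := by
    rw [← Real.sqrt_sq (by positivity : 0 ≤ √(2 : ℝ) ^ n), ← pow_mul, mul_comm n 2, pow_mul,
      Real.sq_sqrt (by norm_num)]
  have hb := coshBound_eq hs hm₀ hc0 hc
  rw [← hN, ← hM] at hb
  rw [div_eq_mul_one_div (Fintype.card ι : ℝ), mul_assoc (Fintype.card ι : ℝ), ← hb, hsq]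
  simp only [Finset.sum_const, Finset.card_univ, Fintype.card_fun, Fintype.card_prod,
    Fintype.card_bool, Fintype.card_fin, nsmul_eq_mul]
  push_cast
  simp only [mul_pow]
  ring

end Bound

theorem lemma5p1 {ι : Type*} [Fintype ι] [Nonempty ι]
    (m : ι → ℝ) (hm : ∀ a, 0 < m a) (s : ℝ) (hs : 0 < s)
    (n : ℕ) (hn : 1 ≤ n) (C : Set (Fin n → ℝ)) (hpoly : IsOpenPolyhedron C)
    (hC : lamHalfPi n ∈ C) (hsub : C ⊆ Set.univ.pi fun _ => Set.Ioo (-Real.pi) 0) :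
    IsNuclear ((projAntisymm n ι).comp (opX hm hs hC)) ∧
      (boundaryDist C < Real.pi / 2 →
        nuclearNorm ((projAntisymm n ι).comp (opX hm hs hC)) ≤
          (2 : ℝ) ^ n / (n.factorial : ℝ) *
            ((Fintype.card ι : ℝ) / Real.sqrt (Real.pi / 2 * massGap m) *
              (Real.exp (-(s * massGap m / 2) * Real.cos (boundaryDist C)) /
                (boundaryDist C * Real.sqrt (s * Real.cos (boundaryDist C))))) ^ n) := by
  have hopen : IsOpen C := by
    obtain ⟨F, -, rfl⟩ := hpoly
    exact isOpen_interior
  have hd := boundaryDist_pos hn hopen hC hsub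
  have hgap : 0 < massGap m := (Finset.lt_inf'_iff _).2 fun i _ => hm i
  have hgap' : ∀ i, massGap m ≤ m i := fun i => Finset.inf'_le _ (Finset.mem_univ i)
  -- Strict inequality keeps the closed cube, corners included, inside the open set `C`.
  have main : ∀ c : ℝ, 0 < c → c < Real.pi / 2 → c < boundaryDist C → _ :=
    fun c hc0 hc hcd => nuclear_projAntisymm_opX hm hs hgap hgap' hc0 hc
      (mem_of_abs_lt_boundaryDist hC hc0.le hcd) hC
  refine ⟨?_, fun hlt => ?_⟩
  -- Nuclearity needs only some admissible `c`, so the case of distance π/2 is covered too.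
  · have hmin : 0 < min (boundaryDist C) (Real.pi / 2) := lt_min hd (half_pos Real.pi_pos)
    exact (main (min (boundaryDist C) (Real.pi / 2) / 2) (by linarith)
      ((half_lt_self hmin).trans_le (min_le_right _ _))
      ((half_lt_self hmin).trans_le (min_le_left _ _))).1
  · set d := boundaryDist C with hdd
    have hcos : 0 < Real.cos d := Real.cos_pos_of_mem_Ioo ⟨by linarith, hlt⟩
    have hcont : ContinuousAt (fun c : ℝ => (2 : ℝ) ^ n / (n.factorial : ℝ) *
        ((Fintype.card ι : ℝ) / √(Real.pi / 2 * massGap m) *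
          (Real.exp (-(s * massGap m / 2) * Real.cos c) / (c * √(s * Real.cos c)))) ^ n) d := by
      have hne : d * √(s * Real.cos d) ≠ 0 :=
        mul_ne_zero hd.ne' (Real.sqrt_pos.2 (by positivity)).ne'
      fun_prop (disch := assumption)
    -- The nuclear norm is independent of `c`, and the bound is continuous at `d`, where `cos d >
    -- 0`; hence `c` may increase to `d`.
    refine ge_of_tendsto (hcont.tendsto.mono_left (nhdsWithin_le_nhds (s := Set.Iio d))) ?_
    filter_upwards [Ioo_mem_nhdsLT hd] with c hc
    exact (main c hc.1 (hc.2.trans hlt) hc.2).2
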